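/- Let $\mathbb F$ be an algebraically closed field and let $q\in\mathbb F$ be nonzero and not a root of unity. Let $\triangle_q$ be the unital associative $\mathbb F$-algebra with generators $A,B,C$ and relations stating that each of $$A+\frac{qBC-q^{-1}CB}{q^2-q^{-2}},\qquad B+\frac{qCA-q^{-1}AC}{q^2-q^{-2}},\qquad C+\frac{qAB-q^{-1}BA}{q^2-q^{-2}}$$ commutes with $A,B,C$. Let $\mathfrak H_q$ be the unital associative $\mathbb F$-algebra with generators $t_i^{\pm1}$ $(i=0,1,2,3)$ and relations $t_it_i^{-1}=t_i^{-1}t_i=1$, $t_i+t_i^{-1}$ is central for each $i$, and $t_0t_1t_2t_3=q^{-1}$. Every $\mathfrak H_q$-module is viewed as a $\triangle_q$-module via the algebra homomorphism $\zeta:\triangle_q\to\mathfrak H_q$ with $$A\mapsto t_1t_0+(t_1t_0)^{-1},\qquad B\mapsto t_3t_0+(t_3t_0)^{-1},\qquad C\mapsto t_2t_0+(t_2t_0)^{-1}.$$ For an $\mathfrak H_q$-module $V$ and $\theta\in\mathbb F$ put $V(\theta)=\{v\in V\mid t_0v=\theta v\}$; this is a $\triangle_q$-submodule of $V$. Let $d\ge1$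 be an odd integer and let $k_0,k_1,k_2,k_3\in\mathbb F$ be nonzero with $k_0^2=q^{-d-1}$. Let $E=E(k_0,k_1,k_2,k_3)$ be the $(d+1)$-dimensional $\mathfrak H_q$-module with basis $v_0,\dots,v_d$ on which, with $v_{d+1}:=0$ and $\varrho_i=(k_0k_1k_3q^i-k_2)(k_0k_1k_3q^i-k_2^{-1})$ for odd $i$, $\varrho_i=(1-q^i)(1-k_0^2q^i)$ for even $i$ (so that $\varrho_0=0$ and the terms with $\varrho_0 v_{-1}$ are absent): * for even $i$ with $0\le i\le d-1$: $t_0v_i=k_0^{-1}q^{-i}\varrho_iv_{i-1}+(k_0+k_0^{-1}-k_0^{-1}q^{-i})v_i$, $t_1v_i=-k_1\varrho_iv_{i-1}+k_1v_i+k_1^{-1}v_{i+1}$, $t_2v_i=k_0^{-1}k_1^{-1}k_3^{-1}q^{-i-1}(v_i-v_{i+1})$, $t_3v_i=k_3v_i$; * for odd $i$ with $1\le i\le d$: $t_0v_i=k_0^{-1}q^{-i-1}(v_i-v_{i+1})$, $t_1v_i=k_1^{-1}v_i$, $t_2v_i=\dfrac{\varrho_i}{k_0k_1k_3q^i}v_{i-1}+(k_2+k_2^{-1}-k_0^{-1}k_1^{-1}k_3^{-1}q^{-i})v_i$,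 $t_3v_i=-k_3^{-1}\varrho_iv_{i-1}+k_3^{-1}v_i+k_3v_{i+1}$. Let $E^{1}=E(k_0,k_1,k_2,k_3)^{1\bmod 4}$ be the $\mathfrak H_q$-module obtained by twisting $E$ by the automorphism $t_0\mapsto t_1,\ t_1\mapsto t_2,\ t_2\mapsto t_3,\ t_3\mapsto t_0$ of $\mathfrak H_q$ (so $t_i$ acts on $E^1$ as $t_{i+1}$, index modulo $4$, acts on $E$). **Theorem.** Assume that the $\mathfrak H_q$-module $E^1$ is irreducible. 1. If $k_1^2=1$, then the $\triangle_q$-submodules of $E^1$ are exactly $\{0\}$, $E^1(k_1)$ and $E^1$, and their lattice is the three-element chain $\{0\}\subsetneq E^1(k_1)\subsetneq E^1$. 2. If $k_1^2\ne1$, then the $\triangle_q$-submodules of $E^1$ are exactly $\{0\}$, $E^1(k_1)$, $E^1(k_1^{-1})$ and $E^1$; these four are distinct, and their lattice is the diamond in which $E^1(k_1)$ and $E^1(k_1^{-1})$ are incomparable, each covering $\{0\}$ and each covered by $E^1$. -/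

import Mathlib

namespace DAHA

/-- `q` is nonzero and not a root of unity. -/
class NotRootOfUnity {F : Type*} [Field F] (q : F) : Prop where
  ne_zero : q ≠ 0
  pow_ne_one : ∀ n : ℕ, 0 < n → q ^ n ≠ 1

/-! ### The universal Askey--Wilson algebra -/

/-- The generators `A, B, C` of the universal Askey--Wilson algebra. -/
inductive AWGen : Type
  | A | B | C

/-- The element `x + (q y z - q⁻¹ z y) / (q² - q⁻²)`. -/
def awExpr {F : Type*} [Field F] {R : Type*} [Ring R] [Algebra F R] (q : F) (x y z : R) : R :=
  x + (q ^ 2 - q⁻¹ ^ 2)⁻¹ • (q • (y * z) - q⁻¹ • (z * y))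

/-- The defining relations: each of the three expressions commutes with `A, B, C`. -/
inductive AWRel {F : Type*} [Field F] (q : F) : FreeAlgebra F AWGen → FreeAlgebra F AWGen → Prop
  | relA (g : AWGen) : AWRel q
      (awExpr q (FreeAlgebra.ι F AWGen.A) (FreeAlgebra.ι F AWGen.B) (FreeAlgebra.ι F AWGen.C) *
        FreeAlgebra.ι F g)
      (FreeAlgebra.ι F g *
        awExpr q (FreeAlgebra.ι F AWGen.A) (FreeAlgebra.ι F AWGen.B) (FreeAlgebra.ι F AWGen.C))
  | relB (g : AWGen) : AWRel q
      (awExpr q (FreeAlgebra.ι F AWGen.B) (FreeAlgebra.ι F AWGen.C) (FreeAlgebra.ι F AWGen.A) *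
        FreeAlgebra.ι F g)
      (FreeAlgebra.ι F g *
        awExpr q (FreeAlgebra.ι F AWGen.B) (FreeAlgebra.ι F AWGen.C) (FreeAlgebra.ι F AWGen.A))
  | relC (g : AWGen) : AWRel q
      (awExpr q (FreeAlgebra.ι F AWGen.C) (FreeAlgebra.ι F AWGen.A) (FreeAlgebra.ι F AWGen.B) *
        FreeAlgebra.ι F g)
      (FreeAlgebra.ι F g *
        awExpr q (FreeAlgebra.ι F AWGen.C) (FreeAlgebra.ι F AWGen.A) (FreeAlgebra.ι F AWGen.B))

/-- The universal Askey--Wilson algebra `△_q`. -/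
def UAW {F : Type*} [Field F] (q : F) : Type _ := RingQuot (AWRel q)

noncomputable instance {F : Type*} [Field F] (q : F) : Ring (UAW q) :=
  inferInstanceAs (Ring (RingQuot (AWRel q)))

noncomputable instance {F : Type*} [Field F] (q : F) : Algebra F (UAW q) :=
  inferInstanceAs (Algebra F (RingQuot (AWRel q)))

/-- The generators as elements of `△_q`. -/
noncomputable def UAW.gen {F : Type*} [Field F] (q : F) (g : AWGen) : UAW q :=
  RingQuot.mkAlgHom F (AWRel q) (FreeAlgebra.ι F g)

/-! ### The universal DAHA of type `(C₁^∨, C₁)` -/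

/-- The generators `t i` and their inverses `tinv i`, for `i = 0, 1, 2, 3` modulo `4`. -/
inductive HGen : Type
  | t (i : ZMod 4)
  | tinv (i : ZMod 4)

/-- The defining relations of the universal DAHA. -/
inductive HRel {F : Type*} [Field F] (q : F) : FreeAlgebra F HGen → FreeAlgebra F HGen → Prop
  | mul_inv (i : ZMod 4) : HRel q
      (FreeAlgebra.ι F (HGen.t i) * FreeAlgebra.ι F (HGen.tinv i)) 1
  | inv_mul (i : ZMod 4) : HRel q
      (FreeAlgebra.ι F (HGen.tinv i) * FreeAlgebra.ι F (HGen.t i)) 1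
  | central (i : ZMod 4) (x : FreeAlgebra F HGen) : HRel q
      ((FreeAlgebra.ι F (HGen.t i) + FreeAlgebra.ι F (HGen.tinv i)) * x)
      (x * (FreeAlgebra.ι F (HGen.t i) + FreeAlgebra.ι F (HGen.tinv i)))
  | prod : HRel q
      (FreeAlgebra.ι F (HGen.t 0) * FreeAlgebra.ι F (HGen.t 1) *
        FreeAlgebra.ι F (HGen.t 2) * FreeAlgebra.ι F (HGen.t 3))
      (algebraMap F (FreeAlgebra F HGen) q⁻¹)

/-- The universal DAHA `𝔥_q` of type `(C₁^∨, C₁)`. -/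
def H {F : Type*} [Field F] (q : F) : Type _ := RingQuot (HRel q)

noncomputable instance {F : Type*} [Field F] (q : F) : Ring (H q) :=
  inferInstanceAs (Ring (RingQuot (HRel q)))

noncomputable instance {F : Type*} [Field F] (q : F) : Algebra F (H q) :=
  inferInstanceAs (Algebra F (RingQuot (HRel q)))

/-- The generator `t_i`. -/
noncomputable def H.t {F : Type*} [Field F] (q : F) (i : ZMod 4) : H q :=
  RingQuot.mkAlgHom F (HRel q) (FreeAlgebra.ι F (HGen.t i))

/-- The generator `t_i⁻¹`. -/
noncomputable def H.tinv {F : Type*} [Field F] (q : F) (i : ZMod 4) : H q :=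
  RingQuot.mkAlgHom F (HRel q) (FreeAlgebra.ι F (HGen.tinv i))

section HBasics

variable {F : Type*} [Field F] (q : F)

theorem H.t_mul_tinv (i : ZMod 4) : H.t q i * H.tinv q i = 1 := by
  have := RingQuot.mkAlgHom_rel F (HRel.mul_inv (q := q) i)
  rwa [map_mul, map_one] at this

theorem H.tinv_mul_t (i : ZMod 4) : H.tinv q i * H.t q i = 1 := by
  have := RingQuot.mkAlgHom_rel F (HRel.inv_mul (q := q) i)
  rwa [map_mul, map_one] at this

theorem H.central (i : ZMod 4) (x : H q) :
    (H.t q i + H.tinv q i) * x = x * (H.t q i + H.tinv q i) := by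
  obtain ⟨y, rfl⟩ := RingQuot.mkAlgHom_surjective F (HRel q) x
  have := RingQuot.mkAlgHom_rel F (HRel.central (q := q) i y)
  rwa [map_mul, map_mul, map_add] at this

theorem H.prod : H.t q 0 * H.t q 1 * H.t q 2 * H.t q 3 = algebraMap F (H q) q⁻¹ := by
  have := RingQuot.mkAlgHom_rel F (HRel.prod (q := q))
  rwa [map_mul, map_mul, map_mul, AlgHom.commutes] at this

/-- An algebra homomorphism out of `𝔥_q` from images of the generators. -/
noncomputable def H.lift {R : Type*} [Ring R] [Algebra F R] (f g : ZMod 4 → R)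
    (h1 : ∀ i, f i * g i = 1) (h2 : ∀ i, g i * f i = 1)
    (h3 : ∀ i x, (f i + g i) * x = x * (f i + g i))
    (h4 : f 0 * f 1 * f 2 * f 3 = algebraMap F R q⁻¹) : H q →ₐ[F] R :=
  RingQuot.liftAlgHom F
    ⟨FreeAlgebra.lift F (fun x : HGen => match x with | .t i => f i | .tinv i => g i), by
      intro x y h
      cases h with
      | mul_inv i => simpa using h1 i
      | inv_mul i => simpa using h2 i
      | central i x => simpa using h3 i _
      | prod => simpa using h4⟩

theorem H.lift_t {R : Type*} [Ring R] [Algebra F R] (f g : ZMod 4 → R) (h1 h2 h3 h4)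
    (i : ZMod 4) : H.lift q f g h1 h2 h3 h4 (H.t q i) = f i := by
  simp only [H.lift, H.t]
  erw [RingQuot.liftAlgHom_mkAlgHom_apply]
  simp

theorem H.lift_tinv {R : Type*} [Ring R] [Algebra F R] (f g : ZMod 4 → R) (h1 h2 h3 h4)
    (i : ZMod 4) : H.lift q f g h1 h2 h3 h4 (H.tinv q i) = g i := by
  simp only [H.lift, H.tinv]
  erw [RingQuot.liftAlgHom_mkAlgHom_apply]
  simp

theorem H.hom_ext {R : Type*} [Ring R] [Algebra F R] {φ ψ : H q →ₐ[F] R}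
    (h1 : ∀ i, φ (H.t q i) = ψ (H.t q i)) (h2 : ∀ i, φ (H.tinv q i) = ψ (H.tinv q i)) :
    φ = ψ := by
  refine RingQuot.ringQuot_ext' F φ ψ ?_
  ext x
  cases x with
  | t i => exact h1 i
  | tinv i => exact h2 i

theorem H.cyc {R : Type*} [Ring R] [Algebra F R] {a b x : R} (r : F)
    (h2 : b * a = 1) (h : a * x = algebraMap F R r) :
    x * a = algebraMap F R r := by
  have hx : x = b * algebraMap F R r := by rw [← h, ← mul_assoc, h2, one_mul]
  rw [hx, mul_assoc, Algebra.commutes, ← mul_assoc, h2, one_mul]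

theorem H.prod_shift (e : ZMod 4) :
    H.t q (0 + e) * H.t q (1 + e) * H.t q (2 + e) * H.t q (3 + e) = algebraMap F (H q) q⁻¹ := by
  have h0 := H.prod q
  have h1 : H.t q 1 * H.t q 2 * H.t q 3 * H.t q 0 = algebraMap F (H q) q⁻¹ :=
    H.cyc q⁻¹ (H.tinv_mul_t q 0) (by simpa only [mul_assoc] using h0)
  have h2 : H.t q 2 * H.t q 3 * H.t q 0 * H.t q 1 = algebraMap F (H q) q⁻¹ :=
    H.cyc q⁻¹ (H.tinv_mul_t q 1) (by simpa only [mul_assoc] using h1)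
  have h3 : H.t q 3 * H.t q 0 * H.t q 1 * H.t q 2 = algebraMap F (H q) q⁻¹ :=
    H.cyc q⁻¹ (H.tinv_mul_t q 2) (by simpa only [mul_assoc] using h2)
  fin_cases e
  · exact h0
  · exact h1
  · exact h2
  · exact h3

/-- The endomorphism `t_i ↦ t_{i+e}`. -/
noncomputable def H.shiftHom (e : ZMod 4) : H q →ₐ[F] H q :=
  H.lift q (fun i => H.t q (i + e)) (fun i => H.tinv q (i + e))
    (fun _ => H.t_mul_tinv q _) (fun _ => H.tinv_mul_t q _) (fun _ x => H.central q _ x)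
    (H.prod_shift q e)

/-- The action of `ℤ/4ℤ` on `𝔥_q`: the class `e` acts as the automorphism `t_i ↦ t_{i+e}`. -/
noncomputable def H.shift (e : ZMod 4) : H q ≃ₐ[F] H q :=
  AlgEquiv.ofAlgHom (H.shiftHom q e) (H.shiftHom q (-e))
    (H.hom_ext q (by intro i; simp [H.shiftHom, H.lift_t]) (by
      intro i; simp [H.shiftHom, H.lift_tinv]))
    (H.hom_ext q (by intro i; simp [H.shiftHom, H.lift_t]) (by
      intro i; simp [H.shiftHom, H.lift_tinv]))

end HBasics

/-! ### The homomorphism `ζ : △_q → 𝔥_q` -/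

/-- `t_i t_0 + (t_i t_0)⁻¹`. -/
noncomputable def H.pair {F : Type*} [Field F] (q : F) (i : ZMod 4) : H q :=
  H.t q i * H.t q 0 + H.tinv q 0 * H.tinv q i

section Zeta

theorem pair_symm {R : Type*} [Ring R] {u u' v v' : R}
    (hu : ∀ x, (u + u') * x = x * (u + u')) (hv : ∀ x, (v + v') * x = x * (v + v')) :
    u * v + v' * u' = v * u + u' * v' := by
  have h1 := hu v
  have h2 := hv u'
  have e : (u * v + v' * u') - (v * u + u' * v') =
      ((u + u') * v - v * (u + u')) + ((v + v') * u' - u' * (v + v')) := by noncomm_ring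
  rw [← sub_eq_zero, e, h1, h2, sub_self, sub_self, add_zero]

theorem pair_commute {R : Type*} [Ring R] {u u' v v' : R}
    (hu : ∀ x, (u + u') * x = x * (u + u')) (hv : ∀ x, (v + v') * x = x * (v + v'))
    (h1 : u * u' = 1) (h2 : u' * u = 1) :
    u * (v * u + u' * v') = (v * u + u' * v') * u := by
  conv_lhs => rw [← pair_symm hu hv]
  have e1 : u * (u * v + v' * u') = u * (u * v + v' * u') * (u' * u) := by rw [h2, mul_one]
  have h3 := pair_symm hu hv
  calc u * (u * v + v' * u') = u * (v * u + u' * v') := by rw [h3]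
    _ = u * v * u + u * u' * v' := by noncomm_ring
    _ = u * v * u + v' * (u' * u) := by rw [h1, h2]; noncomm_ring
    _ = (u * v + v' * u') * u := by noncomm_ring
    _ = _ := by rw [h3]

theorem key_identity {F : Type*} [Field F] {R : Type*} [Ring R] [Algebra F R] (q : F) (hq : q ≠ 0)
    {t0 t1 t2 t3 s0 s1 s2 s3 : R}
    (h0 : ∀ x, (t0 + s0) * x = x * (t0 + s0)) (h1 : ∀ x, (t1 + s1) * x = x * (t1 + s1))
    (h2 : ∀ x, (t2 + s2) * x = x * (t2 + s2)) (h3 : ∀ x, (t3 + s3) * x = x * (t3 + s3))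
    (a0 : t0 * s0 = 1) (b0 : s0 * t0 = 1) (b1 : s1 * t1 = 1)
    (a2 : t2 * s2 = 1) (b2 : s2 * t2 = 1) (a3 : t3 * s3 = 1)
    (hp : t0 * t1 * t2 * t3 = algebraMap F R q⁻¹) :
    (q ^ 2 - q⁻¹ ^ 2) • (t1 * t0 + s0 * s1) +
      (q • ((t3 * t0 + s0 * s3) * (t2 * t0 + s0 * s2)) -
       q⁻¹ • ((t2 * t0 + s0 * s2) * (t3 * t0 + s0 * s3))) =
    (q - q⁻¹) • ((t3 + s3) * (t2 + s2) + (t1 + s1) * (q • s0 + q⁻¹ • t0)) := by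
  have hWW : s2 * s1 * s0 * (t0 * t1 * t2) = 1 := by
    calc s2 * s1 * s0 * (t0 * t1 * t2) = s2 * (s1 * (s0 * t0) * t1) * t2 := by noncomm_ring
      _ = 1 := by rw [b0, mul_one, b1, mul_one, b2]
  have ht3 : t3 = q⁻¹ • (s2 * s1 * s0) := by
    calc t3 = s2 * s1 * s0 * (t0 * t1 * t2) * t3 := by rw [hWW, one_mul]
      _ = s2 * s1 * s0 * (t0 * t1 * t2 * t3) := by noncomm_ring
      _ = _ := by rw [hp, ← Algebra.commutes, Algebra.smul_def]
  have hs3 : s3 = q • (t0 * t1 * t2) := by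
    have : t0 * t1 * t2 = q⁻¹ • s3 := by
      calc t0 * t1 * t2 = t0 * t1 * t2 * t3 * s3 := by rw [mul_assoc _ t3, a3, mul_one]
        _ = _ := by rw [hp, Algebra.smul_def]
    rw [this, smul_smul, mul_inv_cancel₀ hq, one_smul]
  have hB : t3 * t0 + s0 * s3 = q • (t1 * t2) + q⁻¹ • (s2 * s1) := by
    rw [ht3, hs3, smul_mul_assoc, mul_smul_comm, mul_assoc (s2 * s1), b0, mul_one,
      ← mul_assoc, ← mul_assoc, b0, one_mul, add_comm]
  have hA : t1 * t0 + s0 * s1 = t0 * t1 + s1 * s0 := (pair_symm h0 h1).symm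
  have hC : t2 * t0 + s0 * s2 = t0 * t2 + s2 * s0 := (pair_symm h0 h2).symm
  have hBt : t0 * (t3 * t0 + s0 * s3) = (t3 * t0 + s0 * s3) * t0 := pair_commute h0 h3 a0 b0
  rw [hA, hC]
  rw [hB] at hBt ⊢
  have hBs : s0 * (q • (t1 * t2) + q⁻¹ • (s2 * s1)) =
      (q • (t1 * t2) + q⁻¹ • (s2 * s1)) * s0 := by
    generalize q • (t1 * t2) + q⁻¹ • (s2 * s1) = b at hBt
    calc s0 * b = s0 * (b * (t0 * s0)) := by rw [a0, mul_one]
      _ = s0 * (b * t0) * s0 := by noncomm_ring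
      _ = (s0 * t0) * b * s0 := by rw [← hBt]; noncomm_ring
      _ = _ := by rw [b0, one_mul]
  have eBC : (q • (t1 * t2) + q⁻¹ • (s2 * s1)) * (t0 * t2 + s2 * s0) =
      q • (t0 * t1 * t2 * t2) + q⁻¹ • (t0 * s2 * s1 * t2) + q • (t1 * s0) +
        q⁻¹ • (s2 * s1 * s2 * s0) := by
    have e : t1 * s0 = t1 * (t2 * s2) * s0 := by rw [a2, mul_one]
    rw [mul_add, ← mul_assoc, ← hBt, e]
    simp only [mul_add, add_mul, smul_mul_assoc, mul_smul_comm, mul_assoc]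
    abel
  have eCB : (t0 * t2 + s2 * s0) * (q • (t1 * t2) + q⁻¹ • (s2 * s1)) =
      q • (t0 * t2 * t1 * t2) + q⁻¹ • (t0 * s1) + q • (s2 * t1 * t2 * s0) +
        q⁻¹ • (s2 * s2 * s1 * s0) := by
    have e : t0 * s1 = t0 * (t2 * s2) * s1 := by rw [a2, mul_one]
    rw [add_mul, mul_assoc s2, hBs, e]
    simp only [mul_add, add_mul, smul_mul_assoc, mul_smul_comm, mul_assoc]
    abel
  have e1 : t0 * t1 * t2 * t2 + t0 * t1 = (t2 + s2) * (t0 * t1 * t2) := by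
    rw [h2, mul_add, mul_assoc (t0 * t1) t2 s2, a2, mul_one]
  have e2 : s2 * s2 * s1 * s0 + s1 * s0 = (t2 + s2) * (s2 * s1 * s0) := by
    rw [add_mul, ← mul_assoc, ← mul_assoc, a2]; noncomm_ring
  have e3 : t0 * s2 * s1 * t2 + t0 * s2 * t1 * t2 = (t1 + s1) * t0 := by
    calc _ = t0 * s2 * ((t1 + s1) * t2) := by noncomm_ring
      _ = t0 * (s2 * t2) * (t1 + s1) := by rw [h1]; noncomm_ring
      _ = _ := by rw [b2, mul_one, h1]
  have e4 : t0 * s2 * t1 * t2 + t0 * t2 * t1 * t2 = (t2 + s2) * (t0 * t1 * t2) := by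
    calc _ = t0 * ((t2 + s2) * (t1 * t2)) := by noncomm_ring
      _ = _ := by rw [h2, h2]; noncomm_ring
  have e5 : s2 * t1 * t2 * s0 + s2 * s1 * t2 * s0 = (t1 + s1) * s0 := by
    calc _ = s2 * ((t1 + s1) * (t2 * s0)) := by noncomm_ring
      _ = (s2 * t2) * s0 * (t1 + s1) := by rw [h1]; noncomm_ring
      _ = _ := by rw [b2, one_mul, h1]
  have e6 : s2 * s1 * s2 * s0 + s2 * s1 * t2 * s0 = (t2 + s2) * (s2 * s1 * s0) := by
    calc _ = s2 * s1 * ((t2 + s2) * s0) := by noncomm_ring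
      _ = _ := by rw [h2, h2]; noncomm_ring
  have e7 : s1 * s0 + t1 * s0 = (t1 + s1) * s0 := by noncomm_ring
  have e8 : t0 * t1 + t0 * s1 = (t1 + s1) * t0 := by rw [h1]; noncomm_ring
  have e9 : (t3 + s3) * (t2 + s2) =
      q⁻¹ • ((t2 + s2) * (s2 * s1 * s0)) + q • ((t2 + s2) * (t0 * t1 * t2)) := by
    rw [← h2, ht3, hs3, mul_add, mul_smul_comm, mul_smul_comm]
  rw [eBC, eCB, e9, mul_add, mul_smul_comm, mul_smul_comm]
  generalize (t2 + s2) * (s2 * s1 * s0) = P' at *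
  generalize (t2 + s2) * (t0 * t1 * t2) = P at *
  generalize (t1 + s1) * s0 = N at *
  generalize (t1 + s1) * t0 = M at *
  rw [eq_sub_of_add_eq e1, eq_sub_of_add_eq e2, eq_sub_of_add_eq e3,
    eq_sub_of_add_eq' e4, eq_sub_of_add_eq e5, eq_sub_of_add_eq e6, eq_sub_of_add_eq' e7,
    eq_sub_of_add_eq' e8]
  match_scalars <;> field_simp <;> ring

theorem awExpr_commute {F : Type*} [Field F] {R : Type*} [Ring R] [Algebra F R] (q : F)
    [hq : NotRootOfUnity q] {t0 t1 t2 t3 s0 s1 s2 s3 g : R}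
    (h0 : ∀ x, (t0 + s0) * x = x * (t0 + s0)) (h1 : ∀ x, (t1 + s1) * x = x * (t1 + s1))
    (h2 : ∀ x, (t2 + s2) * x = x * (t2 + s2)) (h3 : ∀ x, (t3 + s3) * x = x * (t3 + s3))
    (a0 : t0 * s0 = 1) (b0 : s0 * t0 = 1) (b1 : s1 * t1 = 1)
    (a2 : t2 * s2 = 1) (b2 : s2 * t2 = 1) (a3 : t3 * s3 = 1)
    (hp : t0 * t1 * t2 * t3 = algebraMap F R q⁻¹) (hg : t0 * g = g * t0) :
    awExpr q (t1 * t0 + s0 * s1) (t3 * t0 + s0 * s3) (t2 * t0 + s0 * s2) * g =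
      g * awExpr q (t1 * t0 + s0 * s1) (t3 * t0 + s0 * s3) (t2 * t0 + s0 * s2) := by
  have hq0 : q ≠ 0 := hq.ne_zero
  have hz : q ^ 2 - q⁻¹ ^ 2 ≠ 0 := by
    intro h
    apply hq.pow_ne_one 4 (by norm_num)
    field_simp at h
    linear_combination h
  have key := key_identity q hq0 h0 h1 h2 h3 a0 b0 b1 a2 b2 a3 hp
  have hgs : s0 * g = g * s0 := by
    have := h0 g
    rw [add_mul, mul_add, hg] at this
    exact add_left_cancel this
  have e : awExpr q (t1 * t0 + s0 * s1) (t3 * t0 + s0 * s3) (t2 * t0 + s0 * s2) =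
      (q ^ 2 - q⁻¹ ^ 2)⁻¹ • ((q - q⁻¹) • ((t3 + s3) * (t2 + s2) +
        (t1 + s1) * (q • s0 + q⁻¹ • t0))) := by
    rw [← key, smul_add, smul_smul, inv_mul_cancel₀ hz, one_smul, awExpr]
  have hk : (q • s0 + q⁻¹ • t0) * g = g * (q • s0 + q⁻¹ • t0) := by
    rw [add_mul, mul_add, smul_mul_assoc, smul_mul_assoc, mul_smul_comm, mul_smul_comm, hg, hgs]
  rw [e]
  simp only [smul_mul_assoc, mul_smul_comm]
  congr 2
  have k1 : (t3 + s3) * (t2 + s2) * g = g * ((t3 + s3) * (t2 + s2)) := by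
    rw [mul_assoc, h2 g, ← mul_assoc, h3 g, mul_assoc]
  have k2 : (t1 + s1) * (q • s0 + q⁻¹ • t0) * g = g * ((t1 + s1) * (q • s0 + q⁻¹ • t0)) := by
    rw [mul_assoc, hk, ← mul_assoc, h1 g, mul_assoc]
  rw [add_mul, k1, k2, ← mul_add]

variable {F : Type*} [Field F] (q : F)

theorem H.pair_t0 (i : ZMod 4) : H.t q 0 * H.pair q i = H.pair q i * H.t q 0 :=
  pair_commute (H.central q 0) (H.central q i) (H.t_mul_tinv q 0) (H.tinv_mul_t q 0)

/-- Conjugation of `t_i` by `t_0`, and the facts about it that are used below. -/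
theorem H.conj_facts (i : ZMod 4) :
    (∀ x, (H.tinv q 0 * H.t q i * H.t q 0 + H.tinv q 0 * H.tinv q i * H.t q 0) * x =
      x * (H.tinv q 0 * H.t q i * H.t q 0 + H.tinv q 0 * H.tinv q i * H.t q 0)) ∧
    (H.tinv q 0 * H.t q i * H.t q 0) * (H.tinv q 0 * H.tinv q i * H.t q 0) = 1 ∧
    (H.tinv q 0 * H.tinv q i * H.t q 0) * (H.tinv q 0 * H.t q i * H.t q 0) = 1 ∧
    H.tinv q 0 * H.t q i * H.t q 0 * H.t q 0 + H.tinv q 0 * (H.tinv q 0 * H.tinv q i * H.t q 0) =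
      H.pair q i := by
  have a := H.t_mul_tinv q 0
  have b := H.tinv_mul_t q 0
  have ai := H.t_mul_tinv q i
  have bi := H.tinv_mul_t q i
  have c := H.central q i
  have p := H.pair_t0 q i
  generalize hP : H.pair q i = P at *
  rw [H.pair] at hP
  generalize H.t q 0 = u at *
  generalize H.tinv q 0 = u' at *
  generalize H.t q i = v at *
  generalize H.tinv q i = v' at *
  refine ⟨?_, ?_, ?_, ?_⟩
  · have e : u' * v * u + u' * v' * u = v + v' := by
      calc _ = u' * ((v + v') * u) := by noncomm_ring
        _ = (u' * u) * (v + v') := by rw [c]; noncomm_ring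
        _ = _ := by rw [b, one_mul]
    rw [e]; exact c
  · calc _ = u' * v * (u * u') * v' * u := by noncomm_ring
      _ = u' * (v * v') * u := by rw [a]; noncomm_ring
      _ = 1 := by rw [ai, mul_one, b]
  · calc _ = u' * v' * (u * u') * v * u := by noncomm_ring
      _ = u' * (v' * v) * u := by rw [a]; noncomm_ring
      _ = 1 := by rw [bi, mul_one, b]
  · calc _ = u' * ((v * u + u' * v') * u) := by noncomm_ring
      _ = (u' * u) * P := by rw [hP, ← p]; noncomm_ring
      _ = P := by rw [b, one_mul]

theorem H.relA [NotRootOfUnity q] (g : H q) (hg : H.t q 0 * g = g * H.t q 0) :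
    awExpr q (H.pair q 1) (H.pair q 3) (H.pair q 2) * g =
      g * awExpr q (H.pair q 1) (H.pair q 3) (H.pair q 2) :=
  awExpr_commute q (H.central q 0) (H.central q 1) (H.central q 2) (H.central q 3)
    (H.t_mul_tinv q 0) (H.tinv_mul_t q 0) (H.tinv_mul_t q 1) (H.t_mul_tinv q 2)
    (H.tinv_mul_t q 2) (H.t_mul_tinv q 3) (H.prod q) hg

theorem H.relB [NotRootOfUnity q] (g : H q) (hg : H.t q 0 * g = g * H.t q 0) :
    awExpr q (H.pair q 3) (H.pair q 2) (H.pair q 1) * g =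
      g * awExpr q (H.pair q 3) (H.pair q 2) (H.pair q 1) := by
  obtain ⟨c1, -, c3, c4⟩ := H.conj_facts q 3
  have := awExpr_commute q (H.central q 0) c1 (H.central q 1) (H.central q 2)
    (H.t_mul_tinv q 0) (H.tinv_mul_t q 0) c3 (H.t_mul_tinv q 1)
    (H.tinv_mul_t q 1) (H.t_mul_tinv q 2) (by
      have h : H.t q 3 * H.t q 0 * H.t q 1 * H.t q 2 = algebraMap F (H q) q⁻¹ :=
        H.prod_shift q 3
      rw [← h, ← mul_assoc, ← mul_assoc, H.t_mul_tinv, one_mul]) hg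
  rwa [c4] at this

theorem H.relC [NotRootOfUnity q] (g : H q) (hg : H.t q 0 * g = g * H.t q 0) :
    awExpr q (H.pair q 2) (H.pair q 1) (H.pair q 3) * g =
      g * awExpr q (H.pair q 2) (H.pair q 1) (H.pair q 3) := by
  obtain ⟨c1, -, c3, c4⟩ := H.conj_facts q 2
  obtain ⟨d1, d2, d3, d4⟩ := H.conj_facts q 3
  have := awExpr_commute q (H.central q 0) c1 d1 (H.central q 1)
    (H.t_mul_tinv q 0) (H.tinv_mul_t q 0) c3 d2 d3 (H.t_mul_tinv q 1) (by
      have h : H.t q 2 * H.t q 3 * H.t q 0 * H.t q 1 = algebraMap F (H q) q⁻¹ :=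
        H.prod_shift q 2
      have a := H.t_mul_tinv q 0
      rw [← h]
      generalize H.t q 0 = u at *
      generalize H.tinv q 0 = u' at *
      calc _ = (u * u') * H.t q 2 * (u * u') * H.t q 3 * u * H.t q 1 := by noncomm_ring
        _ = _ := by rw [a, one_mul, mul_one]) hg
  rwa [c4, d4] at this

/-- The images `t_1 t_0 + (t_1 t_0)⁻¹`, `t_3 t_0 + (t_3 t_0)⁻¹`, `t_2 t_0 + (t_2 t_0)⁻¹`
of `A`, `B`, `C` under `ζ`. -/
noncomputable def zetaGen : AWGen → H q
  | .A => H.pair q 1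
  | .B => H.pair q 3
  | .C => H.pair q 2

theorem zetaGen_t0 (g : AWGen) : H.t q 0 * zetaGen q g = zetaGen q g * H.t q 0 := by
  cases g <;> exact H.pair_t0 q _

/-- The algebra homomorphism `ζ : △_q → 𝔥_q`. -/
noncomputable def zeta [NotRootOfUnity q] : UAW q →ₐ[F] H q :=
  RingQuot.liftAlgHom F
    ⟨FreeAlgebra.lift F (zetaGen q), by
      intro x y h
      cases h with
      | relA g => simpa [awExpr, zetaGen] using H.relA q (zetaGen q g) (zetaGen_t0 q g)
      | relB g => simpa [awExpr, zetaGen] using H.relB q (zetaGen q g) (zetaGen_t0 q g)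
      | relC g => simpa [awExpr, zetaGen] using H.relC q (zetaGen q g) (zetaGen_t0 q g)⟩

theorem zeta_gen [NotRootOfUnity q] (g : AWGen) : zeta q (UAW.gen q g) = zetaGen q g := by
  simp only [zeta, UAW.gen]
  erw [RingQuot.liftAlgHom_mkAlgHom_apply]
  simp

theorem zeta_t0 [NotRootOfUnity q] (x : UAW q) : H.t q 0 * zeta q x = zeta q x * H.t q 0 := by
  obtain ⟨y, rfl⟩ := RingQuot.mkAlgHom_surjective F (AWRel q) x
  induction y using FreeAlgebra.induction with
  | grade0 r =>
    have : zeta q (RingQuot.mkAlgHom F (AWRel q) (algebraMap F _ r)) = algebraMap F (H q) r := by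
      rw [AlgHom.commutes]; exact (zeta q).commutes r
    rw [this, Algebra.commutes]
  | grade1 g =>
    have := zetaGen_t0 q g
    rwa [← zeta_gen] at this
  | mul a b ha hb =>
    have e : zeta q (RingQuot.mkAlgHom F (AWRel q) (a * b)) =
        zeta q (RingQuot.mkAlgHom F (AWRel q) a) * zeta q (RingQuot.mkAlgHom F (AWRel q) b) := by
      rw [map_mul]; exact map_mul (zeta q) _ _
    rw [e, ← mul_assoc, ha, mul_assoc, hb, mul_assoc]
  | add a b ha hb =>
    have e : zeta q (RingQuot.mkAlgHom F (AWRel q) (a + b)) =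
        zeta q (RingQuot.mkAlgHom F (AWRel q) a) + zeta q (RingQuot.mkAlgHom F (AWRel q) b) := by
      rw [map_add]; exact map_add (zeta q) _ _
    rw [e, mul_add, add_mul, ha, hb]

end Zeta

/-! ### Modules -/

/-- The twist `V^ε` of an `𝔥_q`-module `V` by an automorphism `ε`. -/
def Twist {F : Type*} [Field F] {q : F} (_ε : H q ≃ₐ[F] H q) (V : Type*) : Type _ := V

section Modules

variable {F : Type*} [Field F] {q : F}

instance (ε : H q ≃ₐ[F] H q) (V : Type*) [AddCommGroup V] : AddCommGroup (Twist ε V) :=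
  inferInstanceAs (AddCommGroup V)

instance (ε : H q ≃ₐ[F] H q) (V : Type*) [AddCommGroup V] [Module F V] : Module F (Twist ε V) :=
  inferInstanceAs (Module F V)

/-- On `V^ε` an element `x` acts as `ε x` acts on `V`. -/
noncomputable instance (ε : H q ≃ₐ[F] H q) (V : Type*) [AddCommGroup V] [Module (H q) V] :
    Module (H q) (Twist ε V) :=
  Module.compHom V (ε : H q →+* H q)

instance (ε : H q ≃ₐ[F] H q) (V : Type*) [AddCommGroup V] [Module F V] [Module (H q) V]
    [IsScalarTower F (H q) V] : IsScalarTower F (H q) (Twist ε V) where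
  smul_assoc a x v := by
    have h : ∀ w : V, ε (a • x) • w = a • ε x • w := fun w => by rw [map_smul, smul_assoc]
    exact h v

/-- Each `𝔥_q`-module is viewed as a `△_q`-module by pulling back via `ζ`. -/
noncomputable instance instModuleUAW [NotRootOfUnity q] (V : Type*) [AddCommGroup V]
    [Module (H q) V] : Module (UAW q) V :=
  Module.compHom V (zeta q : UAW q →+* H q)

/-- The eigenspace `V(θ) = {v | t_0 v = θ v}`, as a `△_q`-submodule of `V`. -/
noncomputable def eigen (q : F) [NotRootOfUnity q] (V : Type*) [AddCommGroup V] [Module F V]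
    [Module (H q) V] [IsScalarTower F (H q) V] (θ : F) : Submodule (UAW q) V where
  carrier := {v | H.t q 0 • v = θ • v}
  zero_mem' := by simp
  add_mem' := by
    intro a b ha hb
    simp only [Set.mem_ofPred_eq] at *
    rw [smul_add, smul_add, ha, hb]
  smul_mem' := by
    intro x v hv
    simp only [Set.mem_ofPred_eq] at *
    change H.t q 0 • (zeta q x • v) = θ • (zeta q x • v)
    rw [← mul_smul, zeta_t0, mul_smul, hv]
    rw [← algebraMap_smul (H q) θ v, ← algebraMap_smul (H q) θ, ← mul_smul, ← mul_smul,
      Algebra.commutes]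

end Modules

/-! ### The module `E(k₀, k₁, k₂, k₃)` -/

/-- The conditions on the parameters of `E(k₀, k₁, k₂, k₃)`: `d` is odd, the `k_i` are nonzero and
`k₀² = q^{-d-1}`. -/
structure Admissible {F : Type*} [Field F] (q : F) (d : ℕ) (k0 k1 k2 k3 : F) : Prop where
  odd : Odd d
  ne0 : k0 ≠ 0
  ne1 : k1 ≠ 0
  ne2 : k2 ≠ 0
  ne3 : k3 ≠ 0
  sq : k0 ^ 2 = q ^ (-(d : ℤ) - 1)

section ModuleE

variable {F : Type*} [Field F]

/-- The standard basis vector `v_i` of `F^{d+1}` for `0 ≤ i ≤ d` (and `0` for `i > d`). -/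
def vec (F : Type*) [Field F] (d i : ℕ) : Fin (d + 1) → F :=
  if h : i < d + 1 then Pi.single ⟨i, h⟩ 1 else 0

/-- The vector `t_0 v_i`. -/
def act0 (q : F) (d : ℕ) (k0 : F) (i : ℕ) : Fin (d + 1) → F :=
  if i = 0 then k0 • vec F d 0
  else if i = d then k0 • vec F d d
  else if Even i then
    (k0⁻¹ * q⁻¹ ^ i * (1 - q ^ i) * (1 - k0 ^ 2 * q ^ i)) • vec F d (i - 1) +
      (k0 + k0⁻¹ - k0⁻¹ * q⁻¹ ^ i) • vec F d i
  else (k0⁻¹ * q⁻¹ ^ (i + 1)) • (vec F d i - vec F d (i + 1))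

/-- The vector `t_1 v_i`. -/
def act1 (q : F) (d : ℕ) (k0 k1 : F) (i : ℕ) : Fin (d + 1) → F :=
  if i = 0 then k1 • vec F d 0 + k1⁻¹ • vec F d 1
  else if Even i then
    (-k1 * (1 - q ^ i) * (1 - k0 ^ 2 * q ^ i)) • vec F d (i - 1) + k1 • vec F d i +
      k1⁻¹ • vec F d (i + 1)
  else k1⁻¹ • vec F d i

/-- The vector `t_2 v_i`. -/
def act2 (q : F) (d : ℕ) (k0 k1 k2 k3 : F) (i : ℕ) : Fin (d + 1) → F :=
  if Even i then
    (k0⁻¹ * k1⁻¹ * k3⁻¹ * q⁻¹ ^ (i + 1)) • (vec F d i - vec F d (i + 1))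
  else
    ((k0 * k1 * k3 * q ^ i - k2) * (k0 * k1 * k3 * q ^ i - k2⁻¹) / (k0 * k1 * k3 * q ^ i)) •
        vec F d (i - 1) +
      (k2 + k2⁻¹ - k0⁻¹ * k1⁻¹ * k3⁻¹ * q⁻¹ ^ i) • vec F d i

/-- The vector `t_3 v_i`. -/
def act3 (q : F) (d : ℕ) (k0 k1 k2 k3 : F) (i : ℕ) : Fin (d + 1) → F :=
  if Even i then k3 • vec F d i
  else if i = d then
    (-k3⁻¹ * (k0 * k1 * k3 * q ^ d - k2) * (k0 * k1 * k3 * q ^ d - k2⁻¹)) • vec F d (d - 1) +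
      k3⁻¹ • vec F d d
  else
    (-k3⁻¹ * (k0 * k1 * k3 * q ^ i - k2) * (k0 * k1 * k3 * q ^ i - k2⁻¹)) • vec F d (i - 1) +
      k3⁻¹ • vec F d i + k3 • vec F d (i + 1)

/-- The linear endomorphism of `F^{d+1}` sending `v_i` to `f i` for `0 ≤ i ≤ d`. -/
noncomputable def ofBasis (d : ℕ) (f : ℕ → Fin (d + 1) → F) : Module.End F (Fin (d + 1) → F) :=
  (Pi.basisFun F (Fin (d + 1))).constr F (fun i => f i)

/-- The operators of `t_0, t_1, t_2, t_3` on `F^{d+1}`. -/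
noncomputable def opE (q : F) (d : ℕ) (k0 k1 k2 k3 : F) (i : ZMod 4) :
    Module.End F (Fin (d + 1) → F) :=
  if i = 0 then ofBasis d (act0 q d k0)
  else if i = 1 then ofBasis d (act1 q d k0 k1)
  else if i = 2 then ofBasis d (act2 q d k0 k1 k2 k3)
  else ofBasis d (act3 q d k0 k1 k2 k3)

/-- The parameter `k_i`. -/
def kE (k0 k1 k2 k3 : F) (i : ZMod 4) : F :=
  if i = 0 then k0 else if i = 1 then k1 else if i = 2 then k2 else k3

theorem ofBasis_vec (d : ℕ) (f : ℕ → Fin (d + 1) → F) {i : ℕ} (hi : i ≤ d) :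
    ofBasis d f (vec F d i) = f i := by
  have h : i < d + 1 := by omega
  have e : vec F d i = Pi.basisFun F (Fin (d + 1)) ⟨i, h⟩ := by simp [vec, h]
  rw [e, ofBasis, Module.Basis.constr_basis]

theorem vec_of_lt {d i : ℕ} (h : d < i) : vec F d i = 0 := by
  simp [vec, show ¬ i < d + 1 by omega]

theorem ext_vec {d : ℕ} {f g : Module.End F (Fin (d + 1) → F)}
    (h0 : f (vec F d 0) = g (vec F d 0))
    (h1 : ∀ m, f (vec F d (2 * m + 1)) = g (vec F d (2 * m + 1)))
    (h2 : ∀ m, f (vec F d (2 * m + 2)) = g (vec F d (2 * m + 2))) : f = g := by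
  refine (Pi.basisFun F (Fin (d + 1))).ext fun i => ?_
  have e : Pi.basisFun F (Fin (d + 1)) i = vec F d i := by
    simp [vec, Nat.le_of_lt_succ i.2]
  rw [e]
  obtain ⟨i, hi⟩ := i
  rcases Nat.even_or_odd' i with ⟨m, rfl | rfl⟩
  · cases m with
    | zero => exact h0
    | succ m => exact h2 m
  · exact h1 m

section Formulas

variable {q : F} {d : ℕ} {k0 k1 k2 k3 : F}

theorem Admissible.sq' (h : Admissible q d k0 k1 k2 k3) : k0 ^ 2 = (q ^ (d + 1))⁻¹ := by
  rw [h.sq, show -(d : ℤ) - 1 = -((d + 1 : ℕ) : ℤ) by push_cast; ring, zpow_neg, zpow_natCast]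

theorem Admissible.coef (hq : q ≠ 0) (h : Admissible q d k0 k1 k2 k3) {m : ℕ}
    (hm : d = 2 * m + 1) : 1 - k0 ^ 2 * q ^ (2 * m + 2) = 0 := by
  rw [h.sq', hm, show 2 * m + 1 + 1 = 2 * m + 2 by ring, inv_mul_cancel₀ (pow_ne_zero _ hq),
    sub_self]

theorem T0_zero : ofBasis d (act0 q d k0) (vec F d 0) = k0 • vec F d 0 := by
  rw [ofBasis_vec d _ (Nat.zero_le d)]; simp [act0]

theorem T0_odd (hq : q ≠ 0) (h : Admissible q d k0 k1 k2 k3) (m : ℕ) :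
    ofBasis d (act0 q d k0) (vec F d (2 * m + 1)) =
      (k0⁻¹ * q⁻¹ ^ (2 * m + 2)) • (vec F d (2 * m + 1) - vec F d (2 * m + 2)) := by
  by_cases hd : 2 * m + 1 ≤ d
  · rw [ofBasis_vec d _ hd, act0]
    by_cases he : 2 * m + 1 = d
    · have hs := h.coef hq he.symm
      have hk := h.ne0
      rw [if_neg (by omega), if_pos he, vec_of_lt (i := 2 * m + 2) (by omega), sub_zero, ← he]
      congr 1
      rw [inv_pow]
      field_simp
      linear_combination (-1 : F) * hs
    · rw [if_neg (by omega), if_neg he, if_neg (by simp)]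
  · rw [vec_of_lt (by omega), vec_of_lt (by omega)]; simp

theorem T0_even (hq : q ≠ 0) (h : Admissible q d k0 k1 k2 k3) (m : ℕ) :
    ofBasis d (act0 q d k0) (vec F d (2 * m + 2)) =
      (k0⁻¹ * q⁻¹ ^ (2 * m + 2) * (1 - q ^ (2 * m + 2)) * (1 - k0 ^ 2 * q ^ (2 * m + 2))) •
        vec F d (2 * m + 1) +
      (k0 + k0⁻¹ - k0⁻¹ * q⁻¹ ^ (2 * m + 2)) • vec F d (2 * m + 2) := by
  by_cases hd : 2 * m + 2 ≤ d
  · obtain ⟨n, hn⟩ := h.odd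
    rw [ofBasis_vec d _ hd, act0, if_neg (by omega), if_neg (by omega),
      if_pos (by simp [Nat.even_add])]
    rfl
  · rw [vec_of_lt (i := 2 * m + 2) (by omega)]
    by_cases he : d = 2 * m + 1
    · rw [h.coef hq he]; simp
    · rw [vec_of_lt (by omega)]; simp

theorem T1_zero : ofBasis d (act1 q d k0 k1) (vec F d 0) =
    k1 • vec F d 0 + k1⁻¹ • vec F d 1 := by
  rw [ofBasis_vec d _ (Nat.zero_le d)]; simp [act1]

theorem T1_odd (m : ℕ) : ofBasis d (act1 q d k0 k1) (vec F d (2 * m + 1)) =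
    k1⁻¹ • vec F d (2 * m + 1) := by
  by_cases hd : 2 * m + 1 ≤ d
  · rw [ofBasis_vec d _ hd, act1, if_neg (by omega), if_neg (by simp)]
  · rw [vec_of_lt (by omega)]; simp

theorem T1_even (hq : q ≠ 0) (h : Admissible q d k0 k1 k2 k3) (m : ℕ) :
    ofBasis d (act1 q d k0 k1) (vec F d (2 * m + 2)) =
      (-k1 * (1 - q ^ (2 * m + 2)) * (1 - k0 ^ 2 * q ^ (2 * m + 2))) • vec F d (2 * m + 1) +
      k1 • vec F d (2 * m + 2) + k1⁻¹ • vec F d (2 * m + 3) := by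
  by_cases hd : 2 * m + 2 ≤ d
  · rw [ofBasis_vec d _ hd, act1, if_neg (by omega), if_pos (by simp [Nat.even_add])]
    rfl
  · rw [vec_of_lt (i := 2 * m + 2) (by omega), vec_of_lt (i := 2 * m + 3) (by omega)]
    by_cases he : d = 2 * m + 1
    · rw [h.coef hq he]; simp
    · rw [vec_of_lt (by omega)]; simp

theorem T2_even (m : ℕ) : ofBasis d (act2 q d k0 k1 k2 k3) (vec F d (2 * m)) =
    (k0⁻¹ * k1⁻¹ * k3⁻¹ * q⁻¹ ^ (2 * m + 1)) • (vec F d (2 * m) - vec F d (2 * m + 1)) := by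
  by_cases hd : 2 * m ≤ d
  · rw [ofBasis_vec d _ hd, act2, if_pos (by simp)]
  · rw [vec_of_lt (by omega), vec_of_lt (by omega)]; simp

theorem T2_odd (h : Admissible q d k0 k1 k2 k3) (m : ℕ) :
    ofBasis d (act2 q d k0 k1 k2 k3) (vec F d (2 * m + 1)) =
    ((k0 * k1 * k3 * q ^ (2 * m + 1) - k2) * (k0 * k1 * k3 * q ^ (2 * m + 1) - k2⁻¹) /
      (k0 * k1 * k3 * q ^ (2 * m + 1))) • vec F d (2 * m) +
      (k2 + k2⁻¹ - k0⁻¹ * k1⁻¹ * k3⁻¹ * q⁻¹ ^ (2 * m + 1)) • vec F d (2 * m + 1) := by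
  by_cases hd : 2 * m + 1 ≤ d
  · rw [ofBasis_vec d _ hd, act2, if_neg (by simp)]
    rfl
  · obtain ⟨n, hn⟩ := h.odd
    rw [vec_of_lt (by omega), vec_of_lt (by omega)]; simp

theorem T3_even (m : ℕ) : ofBasis d (act3 q d k0 k1 k2 k3) (vec F d (2 * m)) =
    k3 • vec F d (2 * m) := by
  by_cases hd : 2 * m ≤ d
  · rw [ofBasis_vec d _ hd, act3, if_pos (by simp)]
  · rw [vec_of_lt (by omega)]; simp

theorem T3_odd (h : Admissible q d k0 k1 k2 k3) (m : ℕ) :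
    ofBasis d (act3 q d k0 k1 k2 k3) (vec F d (2 * m + 1)) =
    (-k3⁻¹ * (k0 * k1 * k3 * q ^ (2 * m + 1) - k2) * (k0 * k1 * k3 * q ^ (2 * m + 1) - k2⁻¹)) •
      vec F d (2 * m) + k3⁻¹ • vec F d (2 * m + 1) + k3 • vec F d (2 * m + 2) := by
  by_cases hd : 2 * m + 1 ≤ d
  · rw [ofBasis_vec d _ hd, act3, if_neg (by simp)]
    by_cases he : 2 * m + 1 = d
    · rw [if_pos he, vec_of_lt (i := 2 * m + 2) (by omega), smul_zero, add_zero]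
      subst he
      rfl
    · rw [if_neg he]
      rfl
  · obtain ⟨n, hn⟩ := h.odd
    rw [vec_of_lt (by omega), vec_of_lt (by omega), vec_of_lt (by omega)]; simp

theorem T0_sq (hq : q ≠ 0) (h : Admissible q d k0 k1 k2 k3) :
    ofBasis d (act0 q d k0) * ofBasis d (act0 q d k0) =
      (k0 + k0⁻¹) • ofBasis d (act0 q d k0) - 1 := by
  have n0 := h.ne0
  refine ext_vec ?_ (fun m => ?_) (fun m => ?_)
  · simp only [Module.End.mul_apply, LinearMap.sub_apply, LinearMap.smul_apply,
      Module.End.one_apply, map_smul, T0_zero]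
    match_scalars
    field_simp
    ring
  · simp only [Module.End.mul_apply, LinearMap.sub_apply, LinearMap.smul_apply,
      Module.End.one_apply, map_smul, map_sub, T0_odd hq h, T0_even hq h]
    generalize hQ : q ^ (2 * m + 2) = Q
    have : Q ≠ 0 := hQ ▸ pow_ne_zero _ hq
    simp only [inv_pow, hQ]
    match_scalars <;> field_simp <;> ring
  · simp only [Module.End.mul_apply, LinearMap.sub_apply, LinearMap.smul_apply,
      Module.End.one_apply, map_smul, map_add, T0_odd hq h, T0_even hq h]
    generalize hQ : q ^ (2 * m + 2) = Q
    have : Q ≠ 0 := hQ ▸ pow_ne_zero _ hq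
    simp only [inv_pow, hQ]
    match_scalars <;> field_simp <;> ring

theorem T1_sq (hq : q ≠ 0) (h : Admissible q d k0 k1 k2 k3) :
    ofBasis d (act1 q d k0 k1) * ofBasis d (act1 q d k0 k1) =
      (k1 + k1⁻¹) • ofBasis d (act1 q d k0 k1) - 1 := by
  have n1 := h.ne1
  have T1_one : ofBasis d (act1 q d k0 k1) (vec F d 1) = k1⁻¹ • vec F d 1 := T1_odd 0
  have T1_three (m : ℕ) : ofBasis d (act1 q d k0 k1) (vec F d (2 * m + 3)) =
    k1⁻¹ • vec F d (2 * m + 3) := T1_odd (m + 1)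
  refine ext_vec ?_ (fun m => ?_) (fun m => ?_)
  · simp only [Module.End.mul_apply, LinearMap.sub_apply, LinearMap.smul_apply,
      Module.End.one_apply, map_smul, map_add, T1_zero, T1_one]
    match_scalars <;> field_simp <;> ring
  · simp only [Module.End.mul_apply, LinearMap.sub_apply, LinearMap.smul_apply,
      Module.End.one_apply, map_smul, T1_odd]
    match_scalars <;> field_simp <;> ring
  · simp only [Module.End.mul_apply, LinearMap.sub_apply, LinearMap.smul_apply,
      Module.End.one_apply, map_smul, map_add, T1_odd, T1_three, T1_even hq h]
    match_scalars <;> field_simp <;> ring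

theorem T2_sq (hq : q ≠ 0) (h : Admissible q d k0 k1 k2 k3) :
    ofBasis d (act2 q d k0 k1 k2 k3) * ofBasis d (act2 q d k0 k1 k2 k3) =
      (k2 + k2⁻¹) • ofBasis d (act2 q d k0 k1 k2 k3) - 1 := by
  have n0 := h.ne0
  have n1 := h.ne1
  have n2 := h.ne2
  have n3 := h.ne3
  have ev (m : ℕ) : (ofBasis d (act2 q d k0 k1 k2 k3) * ofBasis d (act2 q d k0 k1 k2 k3))
      (vec F d (2 * m)) =
      ((k2 + k2⁻¹) • ofBasis d (act2 q d k0 k1 k2 k3) - 1) (vec F d (2 * m)) := by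
    simp only [Module.End.mul_apply, LinearMap.sub_apply, LinearMap.smul_apply,
      Module.End.one_apply, map_smul, map_sub, T2_even, T2_odd h]
    generalize hQ : q ^ (2 * m + 1) = Q
    have : Q ≠ 0 := hQ ▸ pow_ne_zero _ hq
    simp only [inv_pow, hQ]
    match_scalars <;> field_simp <;> ring
  refine ext_vec (ev 0) (fun m => ?_) (fun m => ev (m + 1))
  simp only [Module.End.mul_apply, LinearMap.sub_apply, LinearMap.smul_apply,
    Module.End.one_apply, map_smul, map_add, T2_even, T2_odd h]
  generalize hQ : q ^ (2 * m + 1) = Q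
  have : Q ≠ 0 := hQ ▸ pow_ne_zero _ hq
  simp only [inv_pow, hQ]
  match_scalars <;> field_simp <;> ring

theorem T3_sq (h : Admissible q d k0 k1 k2 k3) :
    ofBasis d (act3 q d k0 k1 k2 k3) * ofBasis d (act3 q d k0 k1 k2 k3) =
      (k3 + k3⁻¹) • ofBasis d (act3 q d k0 k1 k2 k3) - 1 := by
  have n2 := h.ne2
  have n3 := h.ne3
  have ev (m : ℕ) : (ofBasis d (act3 q d k0 k1 k2 k3) * ofBasis d (act3 q d k0 k1 k2 k3))
      (vec F d (2 * m)) =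
      ((k3 + k3⁻¹) • ofBasis d (act3 q d k0 k1 k2 k3) - 1) (vec F d (2 * m)) := by
    simp only [Module.End.mul_apply, LinearMap.sub_apply, LinearMap.smul_apply,
      Module.End.one_apply, map_smul, T3_even]
    match_scalars <;> field_simp <;> ring
  have T3_two (m : ℕ) : ofBasis d (act3 q d k0 k1 k2 k3) (vec F d (2 * m + 2)) =
    k3 • vec F d (2 * m + 2) := T3_even (m + 1)
  refine ext_vec (ev 0) (fun m => ?_) (fun m => ev (m + 1))
  simp only [Module.End.mul_apply, LinearMap.sub_apply, LinearMap.smul_apply,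
    Module.End.one_apply, map_smul, map_add, T3_even, T3_two, T3_odd h]
  match_scalars <;> field_simp <;> ring

theorem T_prod (hq : q ≠ 0) (h : Admissible q d k0 k1 k2 k3) :
    ofBasis d (act0 q d k0) * ofBasis d (act1 q d k0 k1) *
      ofBasis d (act2 q d k0 k1 k2 k3) * ofBasis d (act3 q d k0 k1 k2 k3) =
    q⁻¹ • 1 := by
  have n0 := h.ne0
  have n1 := h.ne1
  have n2 := h.ne2
  have n3 := h.ne3
  have T3_two (m : ℕ) : ofBasis d (act3 q d k0 k1 k2 k3) (vec F d (2 * m + 2)) =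
    k3 • vec F d (2 * m + 2) := T3_even (m + 1)
  have T2_two (m : ℕ) : ofBasis d (act2 q d k0 k1 k2 k3) (vec F d (2 * m + 2)) =
    (k0⁻¹ * k1⁻¹ * k3⁻¹ * q⁻¹ ^ (2 * m + 3)) • (vec F d (2 * m + 2) - vec F d (2 * m + 3)) :=
    T2_even (m + 1)
  have T1_one : ofBasis d (act1 q d k0 k1) (vec F d 1) = k1⁻¹ • vec F d 1 := T1_odd 0
  have T1_three (m : ℕ) : ofBasis d (act1 q d k0 k1) (vec F d (2 * m + 3)) =
    k1⁻¹ • vec F d (2 * m + 3) := T1_odd (m + 1)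
  have P0 : (ofBasis d (act0 q d k0) * ofBasis d (act1 q d k0 k1) *
      ofBasis d (act2 q d k0 k1 k2 k3)) (vec F d 0) = (q⁻¹ * k3⁻¹) • vec F d 0 := by
    have e := T2_even (q := q) (d := d) (k0 := k0) (k1 := k1) (k2 := k2) (k3 := k3) 0
    simp only [mul_zero, zero_add, pow_one] at e
    simp only [Module.End.mul_apply, map_smul, map_sub, map_add, e, T1_zero, T1_one, T0_zero]
    match_scalars <;> field_simp <;> ring
  have P2 (m : ℕ) : (ofBasis d (act0 q d k0) * ofBasis d (act1 q d k0 k1) *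
      ofBasis d (act2 q d k0 k1 k2 k3)) (vec F d (2 * m + 2)) =
      (q⁻¹ * k3⁻¹) • vec F d (2 * m + 2) := by
    simp only [Module.End.mul_apply, map_smul, map_sub, map_add, T2_two, T1_even hq h, T1_three,
      T0_even hq h, T0_odd hq h]
    rw [show 2 * m + 3 = 2 * m + 2 + 1 from rfl, pow_succ q⁻¹ (2 * m + 2)]
    generalize hQ : q ^ (2 * m + 2) = Q
    have : Q ≠ 0 := hQ ▸ pow_ne_zero _ hq
    simp only [inv_pow, hQ]
    match_scalars <;> field_simp <;> ring
  have P1 (m : ℕ) : (ofBasis d (act0 q d k0) * ofBasis d (act1 q d k0 k1) *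
      ofBasis d (act2 q d k0 k1 k2 k3)) (vec F d (2 * m + 1)) =
      (q⁻¹) • ((k3 + k3⁻¹) • vec F d (2 * m + 1) -
        ofBasis d (act3 q d k0 k1 k2 k3) (vec F d (2 * m + 1))) := by
    rw [T3_odd h]
    simp only [Module.End.mul_apply, map_smul, map_add, T2_odd h, T1_odd, T0_odd hq h]
    cases m with
    | zero =>
      simp only [mul_zero, zero_add, T1_zero, map_add, map_smul, T0_zero]
      have e := T0_odd hq h 0
      simp only [mul_zero, zero_add] at e
      rw [e]
      match_scalars <;> field_simp <;> ring
    | succ m =>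
      rw [show 2 * (m + 1) = 2 * m + 2 by ring]
      simp only [T1_even hq h, map_add, map_smul, T0_even hq h, T0_odd hq h]
      have e : ofBasis d (act0 q d k0) (vec F d (2 * m + 3)) = _ := T0_odd hq h (m + 1)
      rw [show 2 * (m + 1) = 2 * m + 2 by ring] at e
      rw [e]
      rw [show 2 * m + 2 + 2 = 2 * m + 2 + 1 + 1 from rfl, pow_succ q⁻¹ (2 * m + 2 + 1),
        pow_succ q⁻¹ (2 * m + 2), pow_succ q (2 * m + 2)]
      generalize hQ : q ^ (2 * m + 2) = Q
      have : Q ≠ 0 := hQ ▸ pow_ne_zero _ hq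
      simp only [inv_pow, hQ]
      match_scalars <;> field_simp <;> ring
  have P : ofBasis d (act0 q d k0) * ofBasis d (act1 q d k0 k1) *
      ofBasis d (act2 q d k0 k1 k2 k3) =
      q⁻¹ • ((k3 + k3⁻¹) • 1 - ofBasis d (act3 q d k0 k1 k2 k3)) := by
    refine ext_vec ?_ (fun m => ?_) (fun m => ?_)
    · rw [P0]
      have e := T3_even (q := q) (d := d) (k0 := k0) (k1 := k1) (k2 := k2) (k3 := k3) 0
      simp only [mul_zero] at e
      simp only [LinearMap.sub_apply, LinearMap.smul_apply, Module.End.one_apply, e]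
      module
    · rw [P1]; rfl
    · rw [P2]
      simp only [LinearMap.sub_apply, LinearMap.smul_apply, Module.End.one_apply, T3_two]
      module
  rw [P, smul_mul_assoc, sub_mul, T3_sq h, smul_mul_assoc, one_mul, sub_sub_cancel]

theorem opE_sq (hq : q ≠ 0) (h : Admissible q d k0 k1 k2 k3) (i : ZMod 4) :
    opE q d k0 k1 k2 k3 i * opE q d k0 k1 k2 k3 i =
      (kE k0 k1 k2 k3 i + (kE k0 k1 k2 k3 i)⁻¹) • opE q d k0 k1 k2 k3 i - 1 := by
  unfold opE kE
  split_ifs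
  · exact T0_sq hq h
  · exact T1_sq hq h
  · exact T2_sq hq h
  · exact T3_sq h

end Formulas

/-- The representation of `𝔥_q` on `F^{d+1}`: `t_i` acts as the operator above and `t_i⁻¹` as
`(k_i + k_i⁻¹) - t_i`. -/
noncomputable def repE {q : F} [hq : NotRootOfUnity q] {d : ℕ} {k0 k1 k2 k3 : F}
    (h : Admissible q d k0 k1 k2 k3) : H q →ₐ[F] Module.End F (Fin (d + 1) → F) :=
  H.lift q (opE q d k0 k1 k2 k3)
    (fun i => (kE k0 k1 k2 k3 i + (kE k0 k1 k2 k3 i)⁻¹) • 1 - opE q d k0 k1 k2 k3 i)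
    (fun i => by
      rw [mul_sub, opE_sq hq.ne_zero h, mul_smul_comm, mul_one, sub_sub_cancel])
    (fun i => by
      rw [sub_mul, opE_sq hq.ne_zero h, smul_mul_assoc, one_mul, sub_sub_cancel])
    (fun i x => by
      rw [add_sub_cancel, smul_mul_assoc, mul_smul_comm, one_mul, mul_one])
    (by
      rw [Algebra.algebraMap_eq_smul_one]
      exact T_prod hq.ne_zero h)

/-- The `(d+1)`-dimensional `𝔥_q`-module `E(k₀, k₁, k₂, k₃)`, with underlying space `F^{d+1}`. -/
def E {q : F} {d : ℕ} {k0 k1 k2 k3 : F} (_h : Admissible q d k0 k1 k2 k3) : Type _ :=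
  Fin (d + 1) → F

variable {q : F} {d : ℕ} {k0 k1 k2 k3 : F} (h : Admissible q d k0 k1 k2 k3)

instance : AddCommGroup (E h) := inferInstanceAs (AddCommGroup (Fin (d + 1) → F))

instance : Module F (E h) := inferInstanceAs (Module F (Fin (d + 1) → F))

noncomputable instance [NotRootOfUnity q] : Module (H q) (E h) :=
  Module.compHom (Fin (d + 1) → F)
    (repE h : H q →+* Module.End F (Fin (d + 1) → F))

instance [NotRootOfUnity q] : IsScalarTower F (H q) (E h) where
  smul_assoc a x v := by
    have e : ∀ w : Fin (d + 1) → F, repE h (a • x) w = a • repE h x w := fun w => by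
      rw [map_smul, LinearMap.smul_apply]
    exact e v

/-- The twisted module `E(k₀, k₁, k₂, k₃)^{1 mod 4}`. -/
abbrev E1 : Type _ := Twist (H.shift q 1) (E h)

end ModuleE

end DAHA

namespace DAHA

/-! Write X_a = t_a t_0 + (t_a t_0)⁻¹ for the operators through which △_q acts on V = E¹. They
commute with t_0, and (t_0 - k₁)(t_0 - k₁⁻¹) = 0 on V. Throughout, k is k₁ or k₁⁻¹.

Irreducibility enters through one fact. If W is a nonzero △_q-stable subspace of the k-eigenspace of
t_0, then W + t_1 W + t_2 W + t_3 W is stable under every t_i (`IsQuad.span_stable`), hence equals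
V. Since t_0 - k⁻¹ sends each of the four summands into W, the whole image (t_0 - k⁻¹)V lies in W
(`IsQuad.range_le_of_eigen`). On E¹ this image is the entire k-eigenspace, also when k = k⁻¹
(`ker_eq_range`, `ker_eq_range'`). So a △_q-submodule that meets an eigenspace nontrivially contains
it, and it is either that eigenspace or V (`IsQuad.eq_eigen_or_top`).

There remains a nonzero submodule W that meets both eigenspaces trivially. In that case V = W ⊕ t_0
W. In 2 × 2 blocks over W, stability of W says that the two diagonal blocks of each t_a add up to
the scalar c_a. Then t_a⁻¹ = c_a - t_a behaves like an adjugate, and taking partial traces in the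
product relation gives tr = q² tr for both terms of X_3 restricted to W. Hence X_3 has trace zero on
W (`IsQuad.trace_pair_eq_zero`), and therefore also on V and on the k₁⁻¹-eigenspace, which is
isomorphic to W (`IsQuad.trace_eq_zero_of_disjoint`). On E the operator X_3 is triangular with
explicit diagonal, and the two traces are geometric sums that vanish together only if q⁴ = 1
(`trace_opB_ne_zero`). -/

/-- Operators `t i` with `t i ^ 2 = c i * t i - 1` and cyclic products `t i t (i+1) t (i+2) t (i+3)`
equal to `q⁻¹`: a representation of `𝔥_q` on which the central elements act as scalars. -/
structure IsQuad {F : Type*} [Field F] {V : Type*} [AddCommGroup V] [Module F V] (q : F)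
    (t : ZMod 4 → Module.End F V) (c : ZMod 4 → F) : Prop where
  sq : ∀ i, t i * t i = c i • t i - 1
  prod : ∀ i, t i * t (i + 1) * t (i + 2) * t (i + 3) = q⁻¹ • 1

/-- The operator by which `t_i⁻¹` acts. -/
def quadInv {F : Type*} [Field F] {V : Type*} [AddCommGroup V] [Module F V]
    (t : ZMod 4 → Module.End F V) (c : ZMod 4 → F) (i : ZMod 4) : Module.End F V :=
  c i • 1 - t i

/-- The operator by which `t_i t_0 + (t_i t_0)⁻¹` acts. -/
def quadPair {F : Type*} [Field F] {V : Type*} [AddCommGroup V] [Module F V]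
    (t : ZMod 4 → Module.End F V) (c : ZMod 4 → F) (i : ZMod 4) : Module.End F V :=
  t i * t 0 + quadInv t c 0 * quadInv t c i

/-! ### Stable subspaces of an eigenspace of t_0 -/

namespace IsQuad

variable {F : Type*} [Field F] {V : Type*} [AddCommGroup V] [Module F V] {q : F}
  {t : ZMod 4 → Module.End F V} {c : ZMod 4 → F}

theorem inv_mul (h : IsQuad q t c) (i : ZMod 4) : quadInv t c i * t i = 1 := by
  rw [quadInv, sub_mul, h.sq, smul_mul_assoc, one_mul, sub_sub_cancel]

theorem mul_inv (h : IsQuad q t c) (i : ZMod 4) : t i * quadInv t c i = 1 := by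
  rw [quadInv, mul_sub, h.sq, mul_smul_comm, mul_one, sub_sub_cancel]

theorem mul_three (h : IsQuad q t c) (i : ZMod 4) :
    t i * t (i + 1) * t (i + 2) = q⁻¹ • quadInv t c (i + 3) := by
  calc _ = t i * t (i + 1) * t (i + 2) * (t (i + 3) * quadInv t c (i + 3)) := by
        rw [h.mul_inv, mul_one]
    _ = _ := by rw [← mul_assoc, h.prod, smul_mul_assoc, one_mul]

/-- The product relation trades two cyclically adjacent generators for the inverses of the other
two. This is the only way in which q enters the arguments below. -/
theorem mul_two (h : IsQuad q t c) (i : ZMod 4) :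
    t i * t (i + 1) = q⁻¹ • (quadInv t c (i + 3) * quadInv t c (i + 2)) := by
  calc _ = t i * t (i + 1) * (t (i + 2) * quadInv t c (i + 2)) := by
        rw [h.mul_inv, mul_one]
    _ = _ := by rw [← mul_assoc, h.mul_three, smul_mul_assoc]

theorem inv_mul_inv (h : IsQuad q t c) (hq : q ≠ 0) (i : ZMod 4) :
    quadInv t c (i + 3) * quadInv t c (i + 2) = q • (t i * t (i + 1)) := by
  rw [h.mul_two, smul_smul, mul_inv_cancel₀ hq, one_smul]

theorem inv_three (h : IsQuad q t c) (hq : q ≠ 0) (i : ZMod 4) :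
    quadInv t c (i + 3) * quadInv t c (i + 2) * quadInv t c (i + 1) = q • t i := by
  rw [h.inv_mul_inv hq, smul_mul_assoc, mul_assoc, h.mul_inv, mul_one]

/-- `t_0` commutes with the pairs. -/
theorem pair_comm (h : IsQuad q t c) (i : ZMod 4) :
    t 0 * quadPair t c i = quadPair t c i * t 0 := by
  refine pair_commute (u' := quadInv t c 0) (v' := quadInv t c i) ?_ ?_ (h.mul_inv 0) (h.inv_mul 0)
  all_goals
    intro x
    rw [quadInv, add_sub_cancel, smul_mul_assoc, mul_smul_comm, one_mul, mul_one]

/-- Modulo a subspace of the k-eigenspace that contains w and is stable under the pairs, t_0 acts on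
t_i w as the scalar k⁻¹. This follows by expanding (t_i t_0)⁻¹ w = t_0⁻¹ t_i⁻¹ w with t_j⁻¹ = c_j -
t_j and t_0 w = k w. -/
theorem pair_apply_eigen {k : F} (hc : c 0 = k + k⁻¹)
    (i : ZMod 4) {w : V} (hw : t 0 w = k • w) :
    t 0 (t i w) = k⁻¹ • t i w + (quadPair t c i w - (k⁻¹ * c i) • w) := by
  simp only [quadPair, quadInv, LinearMap.add_apply, Module.End.mul_apply, LinearMap.sub_apply,
    LinearMap.smul_apply, Module.End.one_apply, map_sub, map_smul, hw, hc]
  match_scalars <;> ring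

/-- The `𝔥_q`-submodule generated by a `△_q`-stable subspace of a `t_0`-eigenspace. -/
theorem span_stable (h : IsQuad q t c) (hq : q ≠ 0) {k : F} (hk : k ≠ 0) (hc : c 0 = k + k⁻¹)
    {W : Submodule F V} (hW : ∀ i, ∀ w ∈ W, quadPair t c i w ∈ W)
    (hWk : ∀ w ∈ W, t 0 w = k • w) (a : ZMod 4) {x : V}
    (hx : x ∈ W ⊔ W.map (t 1) ⊔ W.map (t 2) ⊔ W.map (t 3)) :
    t a x ∈ W ⊔ W.map (t 1) ⊔ W.map (t 2) ⊔ W.map (t 3) := by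
  set M := W ⊔ W.map (t 1) ⊔ W.map (t 2) ⊔ W.map (t 3) with hM
  have hWM : W ≤ M := le_sup_left.trans (le_sup_left.trans le_sup_left)
  have m1 : W.map (t 1) ≤ M := le_sup_right.trans (le_sup_left.trans le_sup_left)
  have m2 : W.map (t 2) ≤ M := le_sup_right.trans le_sup_left
  have m3 : W.map (t 3) ≤ M := le_sup_right
  have mem (b : ZMod 4) (w : V) (hw : w ∈ W) : t b w ∈ M := by
    fin_cases b
    · change t 0 w ∈ M
      rw [hWk w hw]
      exact M.smul_mem _ (hWM hw)
    · exact m1 (Submodule.mem_map_of_mem hw)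
    · exact m2 (Submodule.mem_map_of_mem hw)
    · exact m3 (Submodule.mem_map_of_mem hw)
  have e0 (b : ZMod 4) (w : V) (hw : w ∈ W) :
      ∃ w' ∈ W, t 0 (t b w) = k⁻¹ • t b w + w' :=
    ⟨_, W.sub_mem (hW b w hw) (W.smul_mem _ hw), pair_apply_eigen hc b (hWk w hw)⟩
  have m0 (y : V) (hy : y ∈ M) : t 0 y ∈ M := by
    have key (b : ZMod 4) : W.map (t b) ≤ M.comap (t 0) := by
      rintro _ ⟨w, hw, rfl⟩
      obtain ⟨w', hw', e⟩ := e0 b w hw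
      change t 0 (t b w) ∈ M
      rw [e]
      exact M.add_mem (M.smul_mem _ (mem b w hw)) (hWM hw')
    have : M ≤ M.comap (t 0) :=
      sup_le (sup_le (sup_le (fun w hw => mem 0 w hw) (key 1)) (key 2)) (key 3)
    exact this hy
  have s0 (y : V) (hy : y ∈ M) : quadInv t c 0 y ∈ M :=
    M.sub_mem (M.smul_mem _ hy) (m0 y hy)
  have sm (b : ZMod 4) (w : V) (hw : w ∈ W) : quadInv t c b w ∈ M :=
    M.sub_mem (M.smul_mem _ (hWM hw)) (mem b w hw)
  have diag (b : ZMod 4) (w : V) (hw : w ∈ W) : t b (t b w) ∈ M := by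
    have e := LinearMap.congr_fun (h.sq b) w
    change t b (t b w) = c b • t b w - w at e
    rw [e]
    exact M.sub_mem (M.smul_mem _ (mem b w hw)) (hWM hw)
  -- Replacing both factors by their inverses changes t_b t_b' w only by a combination of w, t_b w
  -- and t_b' w, all of which lie in `M`.
  have rev (b b' : ZMod 4) (w : V) (hw : w ∈ W)
      (hs : quadInv t c b (quadInv t c b' w) ∈ M) : t b (t b' w) ∈ M := by
    have e : t b (t b' w) = quadInv t c b (quadInv t c b' w) - (c b * c b') • w
        + c b • t b' w + c b' • t b w := by
      simp only [quadInv, LinearMap.sub_apply, LinearMap.smul_apply, Module.End.one_apply, map_sub,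
        map_smul]
      match_scalars <;> ring
    rw [e]
    exact M.add_mem (M.add_mem (M.sub_mem hs (M.smul_mem _ (hWM hw))) (M.smul_mem _ (mem _ w hw)))
      (M.smul_mem _ (mem _ w hw))
  -- For adjacent indices the product relation turns the word into one containing t_0 or t_0⁻¹,
  -- whose action is already controlled.
  have t12 (w : V) (hw : w ∈ W) : t 1 (t 2 w) ∈ M := by
    have e : t 1 (t 2 w) = q⁻¹ • quadInv t c 0 (quadInv t c 3 w) :=
      LinearMap.congr_fun (h.mul_two 1) w
    rw [e]
    exact M.smul_mem _ (s0 _ (sm 3 w hw))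
  have t23 (w : V) (hw : w ∈ W) : t 2 (t 3 w) ∈ M := by
    have e : t 2 (t 3 w) = q⁻¹ • quadInv t c 1 (quadInv t c 0 w) :=
      LinearMap.congr_fun (h.mul_two 2) w
    rw [e]
    refine M.smul_mem _ (sm 1 _ (W.sub_mem (W.smul_mem _ hw) ?_))
    rw [hWk w hw]
    exact W.smul_mem _ hw
  have t21 (w : V) (hw : w ∈ W) : t 2 (t 1 w) ∈ M := by
    refine rev 2 1 w hw ?_
    have e : quadInv t c 2 (quadInv t c 1 w) = q • t 3 (t 0 w) :=
      LinearMap.congr_fun (h.inv_mul_inv hq 3) w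
    rw [e, hWk w hw, map_smul]
    exact M.smul_mem _ (M.smul_mem _ (mem 3 w hw))
  have t32 (w : V) (hw : w ∈ W) : t 3 (t 2 w) ∈ M := by
    refine rev 3 2 w hw ?_
    have e : quadInv t c 3 (quadInv t c 2 w) = q • t 0 (t 1 w) :=
      LinearMap.congr_fun (h.inv_mul_inv hq 0) w
    rw [e]
    exact M.smul_mem _ (m0 _ (mem 1 w hw))
  -- The indices 3 and 1 are not adjacent, so t_0 is inserted between them: t_3 t_0 t_1 = q⁻¹ t_2⁻¹.
  -- As t_0 t_1 w is k⁻¹ t_1 w up to an element of `W`, the equation can be solved for t_3 t_1 w.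
  have t31 (w : V) (hw : w ∈ W) : t 3 (t 1 w) ∈ M := by
    obtain ⟨w', hw', e'⟩ := e0 1 w hw
    have e : t 3 (t 0 (t 1 w)) = q⁻¹ • quadInv t c 2 w :=
      LinearMap.congr_fun (h.mul_three 3) w
    have e2 : t 3 (t 1 w) = k • (q⁻¹ • quadInv t c 2 w - t 3 w') := by
      rw [← e, e', map_add, map_smul, add_sub_cancel_right, smul_smul, mul_inv_cancel₀ hk, one_smul]
    rw [e2]
    exact M.smul_mem _ (M.sub_mem (M.smul_mem _ (sm 2 w hw)) (mem 3 w' hw'))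
  -- The same device for inverses, with t_1⁻¹ t_0⁻¹ t_3⁻¹ = q t_2.
  have t13 (w : V) (hw : w ∈ W) : t 1 (t 3 w) ∈ M := by
    obtain ⟨w', hw', e'⟩ := e0 3 w hw
    refine rev 1 3 w hw ?_
    have e : quadInv t c 1 (quadInv t c 0 (quadInv t c 3 w)) = q • t 2 w :=
      LinearMap.congr_fun (h.inv_three hq 2) w
    have e1 : quadInv t c 0 (quadInv t c 3 w) =
        k • quadInv t c 3 w + (w' + ((k⁻¹ - k) * c 3) • w) := by
      simp only [quadInv, LinearMap.sub_apply, LinearMap.smul_apply, Module.End.one_apply, map_sub,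
        map_smul, e', hWk w hw, hc]
      match_scalars <;> ring
    have e2 : quadInv t c 1 (quadInv t c 3 w) = k⁻¹ • (q • t 2 w - quadInv t c 1
        (w' + ((k⁻¹ - k) * c 3) • w)) := by
      rw [← e, e1, map_add, map_smul, add_sub_cancel_right, smul_smul, inv_mul_cancel₀ hk, one_smul]
    rw [e2]
    exact M.smul_mem _ (M.sub_mem (M.smul_mem _ (mem 2 w hw))
      (sm 1 _ (W.add_mem hw' (W.smul_mem _ hw))))
  have all (a b : ZMod 4) (hb : b ≠ 0) : W.map (t b) ≤ M.comap (t a) := by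
    rintro _ ⟨w, hw, rfl⟩
    change t a (t b w) ∈ M
    fin_cases a
    · exact m0 _ (mem b w hw)
    · fin_cases b
      exacts [absurd rfl hb, diag 1 w hw, t12 w hw, t13 w hw]
    · fin_cases b
      exacts [absurd rfl hb, t21 w hw, diag 2 w hw, t23 w hw]
    · fin_cases b
      exacts [absurd rfl hb, t31 w hw, t32 w hw, diag 3 w hw]
  have : M ≤ M.comap (t a) :=
    sup_le (sup_le (sup_le (fun w hw => mem a w hw) (all a 1 (by decide))) (all a 2 (by decide)))
      (all a 3 (by decide))
  exact this hx

/-- In an irreducible representation, a nonzero `△_q`-stable subspace of the eigenspace of `t_0`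
for `k` contains the image of `t_0 - k⁻¹`. -/
theorem range_le_of_eigen (h : IsQuad q t c) (hq : q ≠ 0)
    (hirr : ∀ M : Submodule F V, (∀ i, ∀ x ∈ M, t i x ∈ M) → M = ⊥ ∨ M = ⊤)
    {k : F} (hk : k ≠ 0) (hc : c 0 = k + k⁻¹)
    {W : Submodule F V} (hW : ∀ i, ∀ w ∈ W, quadPair t c i w ∈ W)
    (hWk : ∀ w ∈ W, t 0 w = k • w) (hne : W ≠ ⊥) (x : V) : t 0 x - k⁻¹ • x ∈ W := by
  rcases hirr _ (fun i x hx => h.span_stable hq hk hc hW hWk i hx) with hM | hM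
  · refine absurd (le_bot_iff.1 ?_) hne
    rw [← hM]
    exact le_sup_left.trans (le_sup_left.trans le_sup_left)
  · have key (b : ZMod 4) : W.map (t b) ≤ W.comap (t 0 - k⁻¹ • 1) := by
      rintro _ ⟨w, hw, rfl⟩
      change t 0 (t b w) - k⁻¹ • t b w ∈ W
      rw [pair_apply_eigen hc b (hWk w hw), add_sub_cancel_left]
      exact W.sub_mem (hW b w hw) (W.smul_mem _ hw)
    have k0 : W ≤ W.comap (t 0 - k⁻¹ • 1) := by
      intro w hw
      change t 0 w - k⁻¹ • w ∈ W
      rw [hWk w hw]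
      exact W.sub_mem (W.smul_mem _ hw) (W.smul_mem _ hw)
    have : (⊤ : Submodule F V) ≤ W.comap (t 0 - k⁻¹ • 1) := by
      rw [← hM]
      exact sup_le (sup_le (sup_le k0 (key 1)) (key 2)) (key 3)
    exact this (Submodule.mem_top (x := x))

end IsQuad

/-! ### Partial traces in a decomposition V = W ⊕ t_0 W -/

section Blocks

variable {F : Type*} [Field F] {V W : Type*} [AddCommGroup V] [Module F V] [AddCommGroup W]
  [Module F W]

/-- For `2 × 2` block operators `X`, `Y` whose block traces are scalars `a`, `b`, the upper left
block of `X Y` and the lower right block of `(b - Y) (a - X)` have the same trace. -/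
theorem trace_block_mul {i j : W →ₗ[F] V} {p r : V →ₗ[F] W}
    (hpj : p ∘ₗ j = 0) (hri : r ∘ₗ i = 0)
    (hrj : r ∘ₗ j = LinearMap.id) (hone : i ∘ₗ p + j ∘ₗ r = LinearMap.id)
    {X Y : Module.End F V} {a b : F} (hX : p ∘ₗ X ∘ₗ i + r ∘ₗ X ∘ₗ j = a • LinearMap.id)
    (hY : p ∘ₗ Y ∘ₗ i + r ∘ₗ Y ∘ₗ j = b • LinearMap.id) :
    LinearMap.trace F W (p ∘ₗ (X * Y) ∘ₗ i) =
      LinearMap.trace F W (r ∘ₗ ((b • 1 - Y) * (a • 1 - X)) ∘ₗ j) := by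
  have hv (v : V) : v = i (p v) + j (r v) := (LinearMap.congr_fun hone v).symm
  have e1 : p ∘ₗ (X * Y) ∘ₗ i =
      (p ∘ₗ X ∘ₗ i) * (p ∘ₗ Y ∘ₗ i) + (p ∘ₗ X ∘ₗ j) * (r ∘ₗ Y ∘ₗ i) := by
    ext w
    change p (X (Y (i w))) = p (X (i (p (Y (i w))))) + p (X (j (r (Y (i w)))))
    rw [← map_add, ← map_add, ← hv]
  -- Since the diagonal blocks of X add up to a, passing from X to a - X swaps them and negates the
  -- off-diagonal blocks, as the adjugate of a 2 × 2 matrix does.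
  have hX' : r ∘ₗ (a • 1 - X) ∘ₗ j = p ∘ₗ X ∘ₗ i := by
    rw [eq_sub_of_add_eq hX]
    ext w
    have := LinearMap.congr_fun hrj w
    change r (a • j w - X (j w)) = a • w - r (X (j w))
    rw [map_sub, map_smul]
    exact congrArg (fun z => a • z - r (X (j w))) this
  have hY' : r ∘ₗ (b • 1 - Y) ∘ₗ j = p ∘ₗ Y ∘ₗ i := by
    rw [eq_sub_of_add_eq hY]
    ext w
    have := LinearMap.congr_fun hrj w
    change r (b • j w - Y (j w)) = b • w - r (Y (j w))
    rw [map_sub, map_smul]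
    exact congrArg (fun z => b • z - r (Y (j w))) this
  have hXp : p ∘ₗ (a • 1 - X) ∘ₗ j = -(p ∘ₗ X ∘ₗ j) := by
    ext w
    have : p (j w) = 0 := LinearMap.congr_fun hpj w
    change p (a • j w - X (j w)) = -p (X (j w))
    rw [map_sub, map_smul, this, smul_zero, zero_sub]
  have hYr : r ∘ₗ (b • 1 - Y) ∘ₗ i = -(r ∘ₗ Y ∘ₗ i) := by
    ext w
    have : r (i w) = 0 := LinearMap.congr_fun hri w
    change r (b • i w - Y (i w)) = -r (Y (i w))
    rw [map_sub, map_smul, this, smul_zero, zero_sub]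
  have e2 : r ∘ₗ ((b • 1 - Y) * (a • 1 - X)) ∘ₗ j =
      (p ∘ₗ Y ∘ₗ i) * (p ∘ₗ X ∘ₗ i) + (r ∘ₗ Y ∘ₗ i) * (p ∘ₗ X ∘ₗ j) := by
    rw [← neg_mul_neg (r ∘ₗ Y ∘ₗ i), ← hX', ← hY', ← hXp, ← hYr, add_comm]
    generalize (b • 1 - Y : Module.End F V) = Y'
    generalize (a • 1 - X : Module.End F V) = X'
    ext w
    change r (Y' (X' (j w))) = r (Y' (i (p (X' (j w))))) + r (Y' (j (r (X' (j w)))))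
    rw [← map_add, ← map_add, ← hv]
  -- The two blocks contain the same products in opposite order, so their traces agree.
  rw [e1, e2, map_add, map_add, LinearMap.trace_mul_comm F (p ∘ₗ X ∘ₗ i),
    LinearMap.trace_mul_comm F (p ∘ₗ X ∘ₗ j)]

/-- A `△_q`-stable subspace `W` with `V = W ⊕ t_0 W`, given by the inclusion `i` and the
projections `p`, `r` to the two copies of `W`, has trace zero for `t_3 t_0 + (t_3 t_0)⁻¹`. -/
theorem IsQuad.trace_pair_eq_zero {q : F} {t : ZMod 4 → Module.End F V} {c : ZMod 4 → F}
    (h : IsQuad q t c) (hq : q ≠ 0) (hq2 : q ^ 2 ≠ 1) {i : W →ₗ[F] V} {p r : V →ₗ[F] W}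
    (hpi : p ∘ₗ i = LinearMap.id) (hpj : p ∘ₗ (t 0 ∘ₗ i) = 0) (hri : r ∘ₗ i = 0)
    (hrj : r ∘ₗ (t 0 ∘ₗ i) = LinearMap.id)
    (hone : i ∘ₗ p + (t 0 ∘ₗ i) ∘ₗ r = LinearMap.id)
    (hst : ∀ a w, r (quadPair t c a (i w)) = 0) :
    LinearMap.trace F W (p ∘ₗ quadPair t c 3 ∘ₗ i) = 0 := by
  have hpi' (w : W) : p (i w) = w := LinearMap.congr_fun hpi w
  have hpj' (w : W) : p (t 0 (i w)) = 0 := LinearMap.congr_fun hpj w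
  have hri' (w : W) : r (i w) = 0 := LinearMap.congr_fun hri w
  have hrj' (w : W) : r (t 0 (i w)) = w := LinearMap.congr_fun hrj w
  have hv (v : V) : v = i (p v) + t 0 (i (r v)) := (LinearMap.congr_fun hone v).symm
  have sq0 (v : V) : t 0 (t 0 v) = c 0 • t 0 v - v := LinearMap.congr_fun (h.sq 0) v
  -- The inverse of t_0 sends t_0 w to w and w to c_0 w - t_0 w. Its component along t_0 W is
  -- therefore minus the component along W.
  have rs0 (v : V) : r (quadInv t c 0 v) = - p v := by
    change r (c 0 • v - t 0 v) = _
    conv_lhs => rw [hv v]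
    simp only [map_add, map_sub, map_smul, sq0, hri', hrj']
    module
  -- Stability of W under the pair for `a`, read in the t_0 W component, is exactly this condition
  -- on the block trace of t_a.
  have blk (a : ZMod 4) :
      p ∘ₗ t a ∘ₗ i + r ∘ₗ t a ∘ₗ (t 0 ∘ₗ i) = c a • LinearMap.id := by
    ext w
    have e := hst a w
    change r (t a (t 0 (i w)) + quadInv t c 0 (c a • i w - t a (i w))) = 0 at e
    rw [map_add, rs0, map_sub, map_smul, hpi'] at e
    change p (t a (i w)) + r (t a (t 0 (i w))) = c a • w
    rw [← sub_eq_zero, ← e]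
    abel
  have blk' (a : ZMod 4) :
      p ∘ₗ quadInv t c a ∘ₗ i + r ∘ₗ quadInv t c a ∘ₗ (t 0 ∘ₗ i) = c a • LinearMap.id := by
    ext w
    have e : p (t a (i w)) + r (t a (t 0 (i w))) = c a • w := LinearMap.congr_fun (blk a) w
    change p (c a • i w - t a (i w)) + r (c a • t 0 (i w) - t a (t 0 (i w))) = c a • w
    rw [map_sub, map_sub, map_smul, map_smul, hpi', hrj', sub_add_sub_comm, e, add_sub_cancel_right]
  have adj (a b : ZMod 4) : LinearMap.trace F W (p ∘ₗ (t a * t b) ∘ₗ i) =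
      LinearMap.trace F W (r ∘ₗ (quadInv t c b * quadInv t c a) ∘ₗ (t 0 ∘ₗ i)) :=
    trace_block_mul hpj hri hrj hone (blk a) (blk b)
  have adj' (a b : ZMod 4) : LinearMap.trace F W (p ∘ₗ (quadInv t c a * quadInv t c b) ∘ₗ i) =
      LinearMap.trace F W (r ∘ₗ (t b * t a) ∘ₗ (t 0 ∘ₗ i)) := by
    have e := trace_block_mul hpj hri hrj hone (blk' a) (blk' b)
    rwa [show c b • 1 - quadInv t c b = t b from sub_sub_cancel _ _,
      show c a • 1 - quadInv t c a = t a from sub_sub_cancel _ _] at e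
  have e03 : quadInv t c 0 * quadInv t c 3 = q • (t 1 * t 2) := h.inv_mul_inv hq 1
  have e21 : quadInv t c 2 * quadInv t c 1 = q • (t 3 * t 0) := h.inv_mul_inv hq 3
  -- Let tr₁ and tr₂ be the traces of the upper left and lower right blocks. Then `a1` and `a2`
  -- become tr₁(t_3 t_0) = q tr₂(t_1 t_2) and q tr₁(t_3 t_0) = tr₂(t_1 t_2), while `a4` and `a3`
  -- give the same with t_3 t_0 and t_1 t_2 exchanged. As q² ≠ 1, both upper left traces vanish.
  have a1 := adj 3 0
  have a2 := adj' 2 1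
  have a3 := adj' 0 3
  have a4 := adj 1 2
  rw [e03] at a1 a3
  rw [e21] at a2 a4
  simp only [LinearMap.smul_comp, LinearMap.comp_smul, map_smul, smul_eq_mul] at a1 a2 a3 a4
  rw [quadPair, e03, LinearMap.add_comp, LinearMap.comp_add, map_add]
  simp only [LinearMap.smul_comp, LinearMap.comp_smul, map_smul, smul_eq_mul]
  have hq2' : 1 - q ^ 2 ≠ 0 := sub_ne_zero.2 hq2.symm
  have z1 : LinearMap.trace F W (p ∘ₗ (t 3 * t 0) ∘ₗ i) = 0 :=
    (mul_eq_zero.1 (show (1 - q ^ 2) * _ = 0 by linear_combination a1 - q * a2)).resolve_left hq2'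
  have z2 : LinearMap.trace F W (p ∘ₗ (t 1 * t 2) ∘ₗ i) = 0 :=
    (mul_eq_zero.1 (show (1 - q ^ 2) * _ = 0 by linear_combination a4 - q * a3)).resolve_left hq2'
  rw [z1, z2, mul_zero, add_zero]

end Blocks

/-! ### Trichotomy for stable subspaces, according to how they meet the eigenspaces of t_0 -/

namespace IsQuad

variable {F : Type*} [Field F] {V : Type*} [AddCommGroup V] [Module F V] {q : F}
  {t : ZMod 4 → Module.End F V} {c : ZMod 4 → F}

theorem eigen_sub (h : IsQuad q t c) {k : F} (hk : k ≠ 0) (hc : c 0 = k + k⁻¹) (x : V) :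
    t 0 (t 0 x - k • x) = k⁻¹ • (t 0 x - k • x) := by
  have e : t 0 (t 0 x) = c 0 • t 0 x - x := LinearMap.congr_fun (h.sq 0) x
  rw [map_sub, map_smul, e, hc, smul_sub, smul_smul, inv_mul_cancel₀ hk]
  module

/-- If a `△_q`-stable subspace `W` is not killed by `t_0 - k`, then `(t_0 - k) W = (t_0 - k) V`. -/
theorem exists_sub_eq (h : IsQuad q t c) (hq : q ≠ 0)
    (hirr : ∀ M : Submodule F V, (∀ i, ∀ x ∈ M, t i x ∈ M) → M = ⊥ ∨ M = ⊤)
    {k : F} (hk : k ≠ 0) (hc : c 0 = k + k⁻¹)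
    {W : Submodule F V} (hW : ∀ i, ∀ w ∈ W, quadPair t c i w ∈ W)
    (hne : ∃ w ∈ W, t 0 w ≠ k • w) (x : V) : ∃ w ∈ W, t 0 w - k • w = t 0 x - k • x := by
  -- The subspace (t_0 - k)W lies in the k⁻¹-eigenspace, is nonzero by assumption, and is stable
  -- because t_0 commutes with the pairs. The earlier result applies with k⁻¹ in place of k.
  have key := h.range_le_of_eigen hq hirr (inv_ne_zero hk) (by rw [hc, inv_inv, add_comm])
    (W := W.map (t 0 - k • 1)) ?_ ?_ ?_ x
  · rwa [inv_inv] at key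
  · rintro i _ ⟨w, hw, rfl⟩
    refine ⟨quadPair t c i w, hW i w hw, ?_⟩
    have e : t 0 (quadPair t c i w) = quadPair t c i (t 0 w) :=
      LinearMap.congr_fun (h.pair_comm i) w
    change t 0 (quadPair t c i w) - k • quadPair t c i w = quadPair t c i (t 0 w - k • w)
    rw [e, map_sub, map_smul]
  · rintro _ ⟨w, hw, rfl⟩
    exact h.eigen_sub hk hc w
  · obtain ⟨w, hw, hne⟩ := hne
    intro hbot
    have : t 0 w - k • w ∈ W.map (t 0 - k • 1) := ⟨w, hw, rfl⟩
    rw [hbot, Submodule.mem_bot, sub_eq_zero] at this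
    exact hne this

/-- A nonzero `△_q`-stable subspace meeting both eigenspaces of `t_0` trivially forces the trace of
`t_3 t_0 + (t_3 t_0)⁻¹` to vanish, on the whole space and on the eigenspace for `k⁻¹`. -/
theorem trace_eq_zero_of_disjoint [FiniteDimensional F V] (h : IsQuad q t c) (hq : q ≠ 0) (hq2 : q ^ 2 ≠ 1)
    (hirr : ∀ M : Submodule F V, (∀ i, ∀ x ∈ M, t i x ∈ M) → M = ⊥ ∨ M = ⊤)
    {k : F} (hk : k ≠ 0) (hc : c 0 = k + k⁻¹)
    (hker : ∀ x, t 0 x = k⁻¹ • x → ∃ y, t 0 y - k • y = x)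
    {W : Submodule F V} (hW : ∀ i, ∀ w ∈ W, quadPair t c i w ∈ W) (hne : W ≠ ⊥)
    (h1 : ∀ w ∈ W, t 0 w = k • w → w = 0) (h2 : ∀ w ∈ W, t 0 w = k⁻¹ • w → w = 0) :
    LinearMap.trace F V (quadPair t c 3) = 0 ∧
    ∀ π : Module.End F V, (∀ x, t 0 (π x) = k⁻¹ • π x) →
      (∀ x, t 0 x = k⁻¹ • x → π x = x) → LinearMap.trace F V (quadPair t c 3 * π) = 0 := by
  obtain ⟨w₀, hw₀, hw₀'⟩ := (Submodule.ne_bot_iff W).1 hne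
  have ex1 := h.exists_sub_eq hq hirr hk hc hW ⟨w₀, hw₀, fun e => hw₀' (h1 w₀ hw₀ e)⟩
  have ex2 := h.exists_sub_eq hq hirr (inv_ne_zero hk) (by rw [hc, inv_inv, add_comm]) hW
    ⟨w₀, hw₀, fun e => hw₀' (h2 w₀ hw₀ e)⟩
  -- If a + t_0 b = 0, then (t_0 - k)b lies in `W` and in the k⁻¹-eigenspace, so it is zero. Hence b
  -- is a k-eigenvector in `W`, and it vanishes too.
  have inj : Function.Injective (LinearMap.coprod W.subtype (t 0 ∘ₗ W.subtype)) := by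
    rw [← LinearMap.ker_eq_bot, LinearMap.ker_eq_bot']
    rintro ⟨⟨a, ha⟩, ⟨b, hb⟩⟩ e
    replace e : a + t 0 b = 0 := by simpa using e
    have m : t 0 b - k • b ∈ W := by
      rw [eq_neg_of_add_eq_zero_right e]
      exact W.sub_mem (W.neg_mem ha) (W.smul_mem _ hb)
    have b0 : b = 0 := h1 b hb (sub_eq_zero.1 (h2 _ m (h.eigen_sub hk hc b)))
    subst b0
    rw [map_zero, add_zero] at e
    subst e
    rfl
  -- Subtracting a suitable w from v leaves a k⁻¹-eigenvector. It has the form (t_0 - k)y by `hker`,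
  -- hence (t_0 - k)w' with w' in `W`.
  have surj : Function.Surjective (LinearMap.coprod W.subtype (t 0 ∘ₗ W.subtype)) := by
    intro v
    obtain ⟨w, hw, e⟩ := ex2 v
    obtain ⟨y, hy⟩ := hker (v - w) (by
      rw [map_sub, smul_sub, ← sub_eq_zero, sub_sub_sub_comm, e, sub_self])
    obtain ⟨w', hw', e'⟩ := ex1 y
    refine ⟨⟨⟨w - k • w', W.sub_mem hw (W.smul_mem _ hw')⟩, ⟨w', hw'⟩⟩, ?_⟩
    change w - k • w' + t 0 w' = v
    rw [sub_add_eq_add_sub, add_sub_assoc, e', hy, add_sub_cancel]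
  let Φ := LinearEquiv.ofBijective _ ⟨inj, surj⟩
  let i := W.subtype
  let p : V →ₗ[F] W := LinearMap.fst F W W ∘ₗ Φ.symm.toLinearMap
  let r : V →ₗ[F] W := LinearMap.snd F W W ∘ₗ Φ.symm.toLinearMap
  have hΦi (w : W) : Φ.symm (i w) = (w, 0) := by
    rw [LinearEquiv.symm_apply_eq]
    change (w : V) = w + t 0 ((0 : W) : V)
    simp
  have hΦj (w : W) : Φ.symm (t 0 (i w)) = (0, w) := by
    rw [LinearEquiv.symm_apply_eq]
    change t 0 (w : V) = ((0 : W) : V) + t 0 (w : V)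
    simp
  have hv (v : V) : i (p v) + t 0 (i (r v)) = v := Φ.apply_symm_apply v
  have hpi (w : W) : p (i w) = w := congrArg Prod.fst (hΦi w)
  have hri (w : W) : r (i w) = 0 := congrArg Prod.snd (hΦi w)
  have hpj (w : W) : p (t 0 (i w)) = 0 := congrArg Prod.fst (hΦj w)
  have hrj (w : W) : r (t 0 (i w)) = w := congrArg Prod.snd (hΦj w)
  have hst (a : ZMod 4) (w : W) : r (quadPair t c a (i w)) = 0 := hri ⟨_, hW a w w.2⟩
  have tr0 := h.trace_pair_eq_zero hq hq2 (i := i) (p := p) (r := r) (LinearMap.ext hpi)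
    (LinearMap.ext hpj) (LinearMap.ext hri) (LinearMap.ext hrj) (LinearMap.ext hv) hst
  set B := quadPair t c 3
  set b := p ∘ₗ B ∘ₗ i
  have hBi (w : W) : B (i w) = i (b w) := by
    conv_lhs => rw [← hv (B (i w)), hst 3 w, map_zero, map_zero, add_zero]
    rfl
  have hB0 (v : V) : B (t 0 v) = t 0 (B v) := (LinearMap.congr_fun (h.pair_comm 3) v).symm
  constructor
  -- `B` commutes with t_0, so it acts by `b` on both copies of `W`, and its trace is twice that of
  -- `b`.
  · have e : B = (i ∘ₗ b) ∘ₗ p + ((t 0 ∘ₗ i) ∘ₗ b) ∘ₗ r := by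
      ext v
      change B v = i (b (p v)) + t 0 (i (b (r v)))
      conv_lhs => rw [← hv v, map_add, hBi, hB0, hBi]
    rw [e, map_add, LinearMap.trace_comp_comm' p, LinearMap.trace_comp_comm' r]
    have e1 : p ∘ₗ i ∘ₗ b = b := LinearMap.ext fun w => hpi _
    have e2 : r ∘ₗ (t 0 ∘ₗ i) ∘ₗ b = b := LinearMap.ext fun w => hrj _
    rw [e1, e2, tr0, add_zero]
  · intro π hπ hπ'
    -- The map t_0 - k identifies `W` with the k⁻¹-eigenspace and intertwines `b` with `B`. The
    -- inverse identification is given by `r`.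
    let u : W →ₗ[F] V := t 0 ∘ₗ i - k • i
    have hu (w : W) : u w = t 0 (i w) - k • i w := rfl
    have ru (w : W) : r (u w) = w := by rw [hu, map_sub, map_smul, hrj, hri, smul_zero, sub_zero]
    have uru (x : V) (hx : t 0 x = k⁻¹ • x) : u (r x) = x := by
      obtain ⟨y, hy⟩ := hker x hx
      obtain ⟨w, hw, e⟩ := ex1 y
      have : u ⟨w, hw⟩ = x := e.trans hy
      rw [← this, ru]
    have Bu (w : W) : B (u w) = u (b w) := by
      rw [hu, hu, map_sub, map_smul, hB0, hBi]
    have e : B * π = (u ∘ₗ b) ∘ₗ (r ∘ₗ π) := by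
      ext x
      change B (π x) = u (b (r (π x)))
      rw [← Bu, uru _ (hπ x)]
    have e' : (r ∘ₗ π) ∘ₗ u ∘ₗ b = b := by
      ext1 w
      change r (π (u (b w))) = b w
      rw [hπ' (u (b w)) (h.eigen_sub hk hc (i (b w))), ru]
    rw [e, LinearMap.trace_comp_comm', e', tr0]

/-- A `△_q`-stable subspace meeting the eigenspace of `t_0` for `k` nontrivially is this eigenspace
or everything. -/
theorem eq_eigen_or_top (h : IsQuad q t c) (hq : q ≠ 0)
    (hirr : ∀ M : Submodule F V, (∀ i, ∀ x ∈ M, t i x ∈ M) → M = ⊥ ∨ M = ⊤)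
    {k : F} (hk : k ≠ 0) (hc : c 0 = k + k⁻¹)
    (hker : ∀ x, t 0 x = k • x → ∃ y, t 0 y - k⁻¹ • y = x)
    {W : Submodule F V} (hW : ∀ i, ∀ w ∈ W, quadPair t c i w ∈ W)
    (h1 : ∃ w ∈ W, t 0 w = k • w ∧ w ≠ 0) :
    (∀ x, x ∈ W ↔ t 0 x = k • x) ∨ W = ⊤ := by
  obtain ⟨w₀, hw₀, hk₀, hne₀⟩ := h1
  have hU : ∀ x, t 0 x = k • x → x ∈ W := by
    intro x hx
    obtain ⟨y, rfl⟩ := hker x hx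
    -- The part of `W` inside the eigenspace is itself stable and nonzero, so it contains the image
    -- of t_0 - k⁻¹, which by `hker` covers the eigenspace.
    refine (h.range_le_of_eigen hq hirr hk hc (W := W ⊓ LinearMap.ker (t 0 - k • 1)) ?_ ?_ ?_ y).1
    · rintro i w ⟨hw, hw'⟩
      refine ⟨hW i w hw, ?_⟩
      have e : t 0 (quadPair t c i w) = quadPair t c i (t 0 w) :=
        LinearMap.congr_fun (h.pair_comm i) w
      change t 0 (quadPair t c i w) - k • quadPair t c i w = 0
      rw [e, ← map_smul, ← map_sub, show t 0 w - k • w = 0 from hw', map_zero]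
    · rintro w ⟨-, hw⟩
      exact sub_eq_zero.1 hw
    · exact (Submodule.ne_bot_iff _).2 ⟨w₀, ⟨hw₀, sub_eq_zero.2 hk₀⟩, hne₀⟩
  by_cases hall : ∀ w ∈ W, t 0 w = k • w
  · exact Or.inl fun x => ⟨hall x, hU x⟩
  · push Not at hall
    refine Or.inr (eq_top_iff.2 fun x _ => ?_)
    -- Now (t_0 - k)W = (t_0 - k)V. Each x thus differs from an element of `W` by a k-eigenvector,
    -- which is already known to lie in `W`.
    obtain ⟨w, hw, e⟩ := h.exists_sub_eq hq hirr hk hc hW hall x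
    have : x - w ∈ W := hU _ (by
      rw [map_sub, smul_sub, ← sub_eq_zero, sub_sub_sub_comm, e, sub_self])
    rw [← sub_add_cancel x w]
    exact W.add_mem this hw

end IsQuad

/-! ### Traces on F^{d+1} as sums over pairs of consecutive indices -/

section Traces

variable {F : Type*} [Field F]

theorem vec_apply {d i j : ℕ} (hj : j < d + 1) :
    vec F d i ⟨j, hj⟩ = if i = j then 1 else 0 := by
  unfold vec
  split_ifs with h1 h2 h2
  · subst h2; simp
  · rw [Pi.single_apply, if_neg (by simpa using Ne.symm h2)]
  · omega
  · rfl

theorem trace_eq_sum_pairs {d n : ℕ} (hn : d + 1 = 2 * n) (f : Module.End F (Fin (d + 1) → F))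
    (a b : ℕ → F)
    (ha : ∀ j (hj : 2 * j < d + 1), f (vec F d (2 * j)) ⟨2 * j, hj⟩ = a j)
    (hb : ∀ j (hj : 2 * j + 1 < d + 1), f (vec F d (2 * j + 1)) ⟨2 * j + 1, hj⟩ = b j) :
    LinearMap.trace F _ f = ∑ j ∈ Finset.range n, (a j + b j) := by
  let g : ℕ → F := fun i => if h : i < d + 1 then f (vec F d i) ⟨i, h⟩ else 0
  have e : LinearMap.trace F _ f = ∑ i ∈ Finset.range (d + 1), g i := by
    rw [LinearMap.trace_eq_matrix_trace F (Pi.basisFun F (Fin (d + 1))), Matrix.trace,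
      Finset.sum_range]
    refine Finset.sum_congr rfl fun i _ => ?_
    simp [g, vec, Nat.le_of_lt_succ i.2]
  have s (m : ℕ) : ∑ i ∈ Finset.range (2 * m), g i =
      ∑ j ∈ Finset.range m, (g (2 * j) + g (2 * j + 1)) := by
    induction m with
    | zero => simp
    | succ m ih =>
      rw [show 2 * (m + 1) = 2 * m + 1 + 1 by ring, Finset.sum_range_succ, Finset.sum_range_succ,
        ih, Finset.sum_range_succ, add_assoc]
  rw [e, hn, s]
  refine Finset.sum_congr rfl fun j hj => ?_
  rw [Finset.mem_range] at hj
  have h1 : 2 * j < d + 1 := by omega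
  have h2 : 2 * j + 1 < d + 1 := by omega
  simp only [g, dif_pos h1, dif_pos h2, ha j h1, hb j h2]

end Traces

/-! ### Explicit computations with t_0 and t_1 on E, which act on E¹ as t_3 and t_0 -/

section Explicit

variable {F : Type*} [Field F] {q : F} {d : ℕ} {k0 k1 k2 k3 : F}

/-- The vectors `v_i` with `i` odd lie in the image of `t_1 - k₁`. -/
theorem vec_odd_mem_range (hq : q ≠ 0) (h : Admissible q d k0 k1 k2 k3) (m : ℕ) :
    vec F d (2 * m + 1) ∈ LinearMap.range (ofBasis d (act1 q d k0 k1) - k1 • 1) := by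
  have n1 := h.ne1
  induction m with
  | zero =>
    refine ⟨k1 • vec F d 0, ?_⟩
    simp only [LinearMap.sub_apply, LinearMap.smul_apply, Module.End.one_apply, map_smul, T1_zero]
    match_scalars <;> field_simp
    ring
  | succ m ih =>
    have e : vec F d (2 * (m + 1) + 1) =
        (ofBasis d (act1 q d k0 k1) - k1 • 1) (k1 • vec F d (2 * m + 2)) +
        (k1 * k1 * (1 - q ^ (2 * m + 2)) * (1 - k0 ^ 2 * q ^ (2 * m + 2))) •
          vec F d (2 * m + 1) := by
      simp only [LinearMap.sub_apply, LinearMap.smul_apply, Module.End.one_apply, map_smul,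
        T1_even hq h]
      rw [show 2 * (m + 1) + 1 = 2 * m + 3 by ring]
      match_scalars <;> field_simp <;> ring
    rw [e]
    exact Submodule.add_mem _ ⟨_, rfl⟩ (Submodule.smul_mem _ _ ih)

theorem T1_factor (hq : q ≠ 0) (h : Admissible q d k0 k1 k2 k3) (x : Fin (d + 1) → F) :
    ofBasis d (act1 q d k0 k1) (ofBasis d (act1 q d k0 k1) x) =
      (k1 + k1⁻¹) • ofBasis d (act1 q d k0 k1) x - x :=
  LinearMap.congr_fun (T1_sq hq h) x

/-- The coefficient k₁⁻¹ of v_1 in t_1 v_0 is nonzero. This one vector shows both that no eigenspace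
is everything and that (t_1 - a)E is nonzero. -/
theorem T1_zero_ne (h : Admissible q d k0 k1 k2 k3) (a : F) :
    ofBasis d (act1 q d k0 k1) (vec F d 0) ≠ a • vec F d 0 := by
  intro e
  have hd : 1 < d + 1 := by
    obtain ⟨m, hm⟩ := h.odd
    omega
  have e1 := congrFun e ⟨1, hd⟩
  rw [T1_zero] at e1
  simp [vec_apply, h.ne1] at e1

/-- Here k₁ = k₁⁻¹ and t_1 - k₁ squares to zero, so dividing by k₁ - k₁⁻¹ is impossible. A dimension
count replaces it. -/
theorem ker_eq_range_of_sq_eq_one (hq : q ≠ 0) (h : Admissible q d k0 k1 k2 k3)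
    (hk : k1 ^ 2 = 1) {x : Fin (d + 1) → F} (hx : ofBasis d (act1 q d k0 k1) x = k1 • x) :
    ∃ y, ofBasis d (act1 q d k0 k1) y - k1 • y = x := by
  obtain ⟨n, hn⟩ := h.odd
  have hinv : k1⁻¹ = k1 := inv_eq_of_mul_eq_one_left (by rw [← sq, hk])
  set N := ofBasis d (act1 q d k0 k1) - k1 • 1 with hN
  have le : LinearMap.range N ≤ LinearMap.ker N := by
    rintro _ ⟨y, rfl⟩
    rw [LinearMap.mem_ker]
    simp only [hN, LinearMap.sub_apply, LinearMap.smul_apply, Module.End.one_apply, map_sub,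
      map_smul, T1_factor hq h, hinv]
    match_scalars
    · ring
    · linear_combination hk
  have li : LinearIndependent F (fun j : Fin (n + 1) => vec F d (2 * (j : ℕ) + 1)) := by
    have e : (fun j : Fin (n + 1) => vec F d (2 * (j : ℕ) + 1)) =
        Pi.basisFun F (Fin (d + 1)) ∘ fun j : Fin (n + 1) => ⟨2 * j + 1, by omega⟩ := by
      ext1 j
      have : 2 * (j : ℕ) + 1 < d + 1 := by omega
      simp only [vec, dif_pos this, Function.comp_apply, Pi.basisFun_apply]
    rw [e]
    refine (Pi.basisFun F (Fin (d + 1))).linearIndependent.comp _ fun a b hab => ?_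
    simp only [Fin.mk.injEq] at hab
    exact Fin.ext (by omega)
  have span_le : Submodule.span F (Set.range fun j : Fin (n + 1) => vec F d (2 * (j : ℕ) + 1)) ≤
      LinearMap.range N := by
    rw [Submodule.span_le]
    rintro _ ⟨j, rfl⟩
    exact vec_odd_mem_range hq h j
  have fr := Submodule.finrank_mono span_le
  rw [finrank_span_eq_card li, Fintype.card_fin] at fr
  have rn := LinearMap.finrank_range_add_finrank_ker N
  rw [Module.finrank_fin_fun] at rn
  -- The image contains the n + 1 vectors v_i with i odd, and rank and nullity add up to d + 1 = 2(n
  -- + 1). The kernel is therefore no larger than the image inside it.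
  have eq := Submodule.eq_of_le_of_finrank_le le (by omega)
  have : x ∈ LinearMap.range N := by
    rw [eq, LinearMap.mem_ker]
    exact sub_eq_zero.2 hx
  exact this

theorem ker_eq_range (hq : q ≠ 0) (h : Admissible q d k0 k1 k2 k3)
    {x : Fin (d + 1) → F} (hx : ofBasis d (act1 q d k0 k1) x = k1 • x) :
    ∃ y, ofBasis d (act1 q d k0 k1) y - k1⁻¹ • y = x := by
  by_cases hk : k1 ^ 2 = 1
  · rw [inv_eq_of_mul_eq_one_left (show k1 * k1 = 1 by rw [← sq, hk])]
    exact ker_eq_range_of_sq_eq_one hq h hk hx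
  · have n1 := h.ne1
    have hne : k1 - k1⁻¹ ≠ 0 := fun e => hk (by field_simp at e; linear_combination e)
    refine ⟨(k1 - k1⁻¹)⁻¹ • x, ?_⟩
    rw [map_smul, hx, smul_comm k1⁻¹, ← smul_sub, ← sub_smul, smul_smul, inv_mul_cancel₀ hne,
      one_smul]

theorem ker_eq_range' (hq : q ≠ 0) (h : Admissible q d k0 k1 k2 k3)
    {x : Fin (d + 1) → F} (hx : ofBasis d (act1 q d k0 k1) x = k1⁻¹ • x) :
    ∃ y, ofBasis d (act1 q d k0 k1) y - k1 • y = x := by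
  by_cases hk : k1 ^ 2 = 1
  · rw [inv_eq_of_mul_eq_one_left (show k1 * k1 = 1 by rw [← sq, hk])] at hx
    exact ker_eq_range_of_sq_eq_one hq h hk hx
  · have n1 := h.ne1
    have hne : k1⁻¹ - k1 ≠ 0 := fun e => hk (by field_simp at e; linear_combination -e)
    refine ⟨(k1⁻¹ - k1)⁻¹ • x, ?_⟩
    rw [map_smul, hx, smul_comm k1, ← smul_sub, ← sub_smul, smul_smul, inv_mul_cancel₀ hne,
      one_smul]

/-- The operator of `t_0 t_1 + (t_0 t_1)⁻¹` on `E(k₀, k₁, k₂, k₃)`. -/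
noncomputable def opB (q : F) (d : ℕ) (k0 k1 : F) : Module.End F (Fin (d + 1) → F) :=
  ofBasis d (act0 q d k0) * ofBasis d (act1 q d k0 k1) +
    ((k1 + k1⁻¹) • 1 - ofBasis d (act1 q d k0 k1)) * ((k0 + k0⁻¹) • 1 - ofBasis d (act0 q d k0))

/-- Together with `opB_even` this shows that the operator only raises indices, so its diagonal can
be read off and summed. -/
theorem opB_odd (hq : q ≠ 0) (h : Admissible q d k0 k1 k2 k3) (m : ℕ) :
    opB q d k0 k1 (vec F d (2 * m + 1)) =
      (k0 * k1 * q ^ (2 * m + 2) + (k0 * k1 * q ^ (2 * m + 2))⁻¹) • vec F d (2 * m + 1) +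
      (-(k0 * k1 * q ^ (2 * m + 2))⁻¹) • vec F d (2 * m + 3) := by
  have n0 := h.ne0
  have n1 := h.ne1
  simp only [opB, LinearMap.add_apply, Module.End.mul_apply, LinearMap.sub_apply,
    LinearMap.smul_apply, Module.End.one_apply, map_smul, map_sub, T1_odd, T0_odd hq h,
    T1_even hq h]
  generalize hQ : q ^ (2 * m + 2) = Q
  have : Q ≠ 0 := hQ ▸ pow_ne_zero _ hq
  simp only [inv_pow, hQ]
  match_scalars <;> field_simp <;> ring

theorem opB_even (hq : q ≠ 0) (h : Admissible q d k0 k1 k2 k3) (m : ℕ) :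
    opB q d k0 k1 (vec F d (2 * m)) =
      (k0 * k1 * q ^ (2 * m) + (k0 * k1 * q ^ (2 * m))⁻¹) • vec F d (2 * m) +
      ((k0 * k1 * q ^ (2 * m))⁻¹ * (q⁻¹ ^ 2 - 1)) • vec F d (2 * m + 1) +
      (-(k0 * k1 * q ^ (2 * m))⁻¹ * q⁻¹ ^ 2) • vec F d (2 * m + 2) := by
  have n0 := h.ne0
  have n1 := h.ne1
  cases m with
  | zero =>
    have e1 : ofBasis d (act0 q d k0) (vec F d 1) = _ := T0_odd hq h 0
    simp only [mul_zero, zero_add, inv_pow] at e1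
    simp only [inv_pow, opB, LinearMap.add_apply, Module.End.mul_apply, LinearMap.sub_apply, mul_zero,
      LinearMap.smul_apply, Module.End.one_apply, map_smul, map_sub, map_add, T1_zero, T0_zero, e1]
    match_scalars <;> field_simp <;> ring
  | succ m =>
    have e1 : ofBasis d (act0 q d k0) (vec F d (2 * m + 3)) = _ := T0_odd hq h (m + 1)
    simp only [show 2 * (m + 1) = 2 * m + 2 by ring] at e1 ⊢
    simp only [opB, LinearMap.add_apply, Module.End.mul_apply, LinearMap.sub_apply,
      LinearMap.smul_apply, Module.End.one_apply, map_smul, map_sub, map_add, T1_even hq h,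
      T0_even hq h, T0_odd hq h, T1_odd, e1]
    rw [show 2 * m + 2 + 2 = 2 * m + 2 + 1 + 1 from rfl, pow_succ q⁻¹ (2 * m + 2 + 1),
        pow_succ q⁻¹ (2 * m + 2)]
    generalize hQ : q ^ (2 * m + 2) = Q
    have : Q ≠ 0 := hQ ▸ pow_ne_zero _ hq
    simp only [inv_pow, hQ]
    match_scalars <;> field_simp <;> ring

/-- The projection of `F^{d+1}` onto the span of the `v_i` with `i` odd. -/
noncomputable def oddProj (F : Type*) [Field F] (d : ℕ) : Module.End F (Fin (d + 1) → F) :=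
  ofBasis d fun i => if Even i then 0 else vec F d i

theorem oddProj_even (m : ℕ) : oddProj F d (vec F d (2 * m)) = 0 := by
  by_cases hd : 2 * m ≤ d
  · rw [oddProj, ofBasis_vec d _ hd, if_pos (by simp)]
  · rw [vec_of_lt (by omega), map_zero]

theorem oddProj_odd (m : ℕ) : oddProj F d (vec F d (2 * m + 1)) = vec F d (2 * m + 1) := by
  by_cases hd : 2 * m + 1 ≤ d
  · rw [oddProj, ofBasis_vec d _ hd, if_neg (by simp)]
  · rw [vec_of_lt (by omega), map_zero]

theorem T1_oddProj (x : Fin (d + 1) → F) :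
    ofBasis d (act1 q d k0 k1) (oddProj F d x) = k1⁻¹ • oddProj F d x := by
  have : ofBasis d (act1 q d k0 k1) * oddProj F d = k1⁻¹ • oddProj F d := by
    refine ext_vec ?_ (fun m => ?_) (fun m => ?_)
    · simp [show oddProj F d (vec F d 0) = 0 from oddProj_even 0]
    · simp [oddProj_odd, T1_odd]
    · simp [show oddProj F d (vec F d (2 * m + 2)) = 0 from oddProj_even (m + 1)]
  exact LinearMap.congr_fun this x

/-- The k₁⁻¹-eigenspace is the image of t_1 - k₁, and that operator sends every v_i into the span of
the odd basis vectors. With `T1_oddProj`, this makes `oddProj` a projection onto the eigenspace, as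
the trace criterion requires. -/
theorem oddProj_eq_self (hq : q ≠ 0) (h : Admissible q d k0 k1 k2 k3) {x : Fin (d + 1) → F}
    (hx : ofBasis d (act1 q d k0 k1) x = k1⁻¹ • x) : oddProj F d x = x := by
  obtain ⟨y, rfl⟩ := ker_eq_range' hq h hx
  have p1 : oddProj F d (vec F d 1) = vec F d 1 := oddProj_odd 0
  have p2 (m : ℕ) : oddProj F d (vec F d (2 * m + 2)) = 0 := oddProj_even (m + 1)
  have p3 (m : ℕ) : oddProj F d (vec F d (2 * m + 3)) = vec F d (2 * m + 3) := oddProj_odd (m + 1)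
  have : oddProj F d * (ofBasis d (act1 q d k0 k1) - k1 • 1) =
      ofBasis d (act1 q d k0 k1) - k1 • 1 := by
    refine ext_vec ?_ (fun m => ?_) (fun m => ?_)
    · simp [T1_zero, p1]
    · simp [T1_odd, oddProj_odd]
    · simp only [Module.End.mul_apply, LinearMap.sub_apply, LinearMap.smul_apply,
        Module.End.one_apply, map_sub, map_add, map_smul, T1_even hq h, p2, p3, oddProj_odd]
      module
  exact LinearMap.congr_fun this y

theorem trace_opB (hq : q ≠ 0) (h : Admissible q d k0 k1 k2 k3) {n : ℕ} (hn : d + 1 = 2 * n) :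
    LinearMap.trace F _ (opB q d k0 k1) = ∑ j ∈ Finset.range n,
      ((k0 * k1 * q ^ (2 * j) + (k0 * k1 * q ^ (2 * j))⁻¹) +
        (k0 * k1 * q ^ (2 * j + 2) + (k0 * k1 * q ^ (2 * j + 2))⁻¹)) := by
  refine trace_eq_sum_pairs hn _ _ _ (fun j hj => ?_) (fun j hj => ?_)
  · simp [opB_even hq h, vec_apply]
  · simp [opB_odd hq h, vec_apply]

theorem trace_opB_oddProj (hq : q ≠ 0) (h : Admissible q d k0 k1 k2 k3) {n : ℕ}
    (hn : d + 1 = 2 * n) :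
    LinearMap.trace F _ (opB q d k0 k1 * oddProj F d) = ∑ j ∈ Finset.range n,
      (0 + (k0 * k1 * q ^ (2 * j + 2) + (k0 * k1 * q ^ (2 * j + 2))⁻¹)) := by
  refine trace_eq_sum_pairs hn _ _ _ (fun j hj => ?_) (fun j hj => ?_)
  · simp [oddProj_even]
  · simp [oddProj_odd, opB_odd hq h, vec_apply]

/-- Two geometric sums with denominators cleared. The factor x x⁻¹ on the right keeps the identity
valid for x = 0, where x⁻¹ = 0. -/
theorem sum_pow_add_inv {x : F} (hq : q ≠ 0) (n : ℕ) :
    q ^ (2 * n) * x * (q ^ 2 - 1) * ∑ j ∈ Finset.range n, (x * q ^ (2 * j) + (x * q ^ (2 * j))⁻¹) =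
      (q ^ (2 * n) - 1) * (x ^ 2 * q ^ (2 * n) + x * x⁻¹ * q ^ 2) := by
  induction n with
  | zero => simp
  | succ n ih =>
    rw [Finset.sum_range_succ, mul_add, show q ^ (2 * (n + 1)) * x * (q ^ 2 - 1) *
      ∑ j ∈ Finset.range n, (x * q ^ (2 * j) + (x * q ^ (2 * j))⁻¹) =
      q ^ 2 * (q ^ (2 * n) * x * (q ^ 2 - 1) *
      ∑ j ∈ Finset.range n, (x * q ^ (2 * j) + (x * q ^ (2 * j))⁻¹)) by ring, ih,
      show 2 * (n + 1) = 2 * n + 2 by ring, pow_add]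
    generalize hQ : q ^ (2 * n) = Q
    have : Q ≠ 0 := hQ ▸ pow_ne_zero _ hq
    by_cases hx : x = 0
    · simp [hx]
    · field_simp
      ring

/-- The trace of `t_0 t_1 + (t_0 t_1)⁻¹` cannot vanish both on `E(k₀, k₁, k₂, k₃)` and on the
eigenspace of `t_1` for `k₁⁻¹`. -/
theorem trace_opB_ne_zero [hq : NotRootOfUnity q] (h : Admissible q d k0 k1 k2 k3)
    (h1 : LinearMap.trace F _ (opB q d k0 k1) = 0)
    (h2 : LinearMap.trace F _ (opB q d k0 k1 * oddProj F d) = 0) : False := by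
  obtain ⟨m, hm⟩ := h.odd
  have hn : d + 1 = 2 * (m + 1) := by omega
  have hq0 := hq.ne_zero
  have n0 := h.ne0
  have n1 := h.ne1
  have hqn : q ^ (2 * (m + 1)) - 1 ≠ 0 := sub_ne_zero.2 (hq.pow_ne_one _ (by omega))
  rw [trace_opB hq0 h hn, Finset.sum_add_distrib] at h1
  rw [trace_opB_oddProj hq0 h hn] at h2
  simp only [zero_add] at h2
  rw [h2, add_zero] at h1
  have e1 := sum_pow_add_inv (x := k0 * k1) hq0 (m + 1)
  have e2 := sum_pow_add_inv (x := k0 * k1 * q ^ 2) hq0 (m + 1)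
  have : ∑ j ∈ Finset.range (m + 1), (k0 * k1 * q ^ 2 * q ^ (2 * j) +
      (k0 * k1 * q ^ 2 * q ^ (2 * j))⁻¹) = 0 := by
    rw [← h2]
    refine Finset.sum_congr rfl fun j _ => ?_
    rw [mul_assoc (k0 * k1), ← pow_add, add_comm 2]
  rw [h1, mul_zero] at e1
  rw [this, mul_zero] at e2
  have f1 := (mul_eq_zero.1 e1.symm).resolve_left hqn
  have f2 := (mul_eq_zero.1 e2.symm).resolve_left hqn
  have nx : k0 * k1 ≠ 0 := mul_ne_zero n0 n1
  rw [mul_inv_cancel₀ nx] at f1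
  rw [mul_inv_cancel₀ (mul_ne_zero nx (pow_ne_zero 2 hq0))] at f2
  -- With x = k₀k₁ and N = d + 1, the even and odd diagonal sums vanish only if x² q^N + q² = 0 and
  -- x² q^(N+4) + q² = 0. Eliminating x² leaves q⁶ = q².
  have f3 : q ^ 2 * (q ^ 4 - 1) = 0 := by
    linear_combination q ^ 4 * f1 - f2
  exact hq.pow_ne_one 4 (by norm_num)
    (sub_eq_zero.1 ((mul_eq_zero.1 f3).resolve_left (pow_ne_zero 2 hq0)))

end Explicit

/-! ### Passage between modules over 𝔥_q and △_q and operators on F^{d+1} -/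

section Transfer

variable {F : Type*} [Field F] {q : F}

/-- Stability under the generators suffices, so irreducibility over 𝔥_q can be used on subspaces
tested only against the t_i. -/
theorem H.apply_mem {V : Type*} [AddCommGroup V] [Module F V] (φ : H q →ₐ[F] Module.End F V)
    {M : Submodule F V} (h1 : ∀ i, ∀ v ∈ M, φ (H.t q i) v ∈ M)
    (h2 : ∀ i, ∀ v ∈ M, φ (H.tinv q i) v ∈ M) (x : H q) : ∀ v ∈ M, φ x v ∈ M := by
  obtain ⟨y, rfl⟩ := RingQuot.mkAlgHom_surjective F (HRel q) x
  let ψ : FreeAlgebra F HGen →ₐ[F] Module.End F V := AlgHom.comp φ (RingQuot.mkAlgHom F (HRel q))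
  change ∀ v ∈ M, ψ y v ∈ M
  induction y using FreeAlgebra.induction with
  | grade0 r =>
    intro v hv
    rw [AlgHom.commutes]
    exact M.smul_mem r hv
  | grade1 g =>
    cases g with
    | t i => exact h1 i
    | tinv i => exact h2 i
  | mul a b ha hb =>
    intro v hv
    rw [map_mul]
    exact ha _ (hb v hv)
  | add a b ha hb =>
    intro v hv
    rw [map_add]
    exact M.add_mem (ha v hv) (hb v hv)

theorem H.shift_t (e i : ZMod 4) : H.shift q e (H.t q i) = H.t q (i + e) := H.lift_t ..

theorem H.shift_tinv (e i : ZMod 4) : H.shift q e (H.tinv q i) = H.tinv q (i + e) :=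
  H.lift_tinv ..

variable [hq : NotRootOfUnity q] {d : ℕ} {k0 k1 k2 k3 : F} (h : Admissible q d k0 k1 k2 k3)

theorem repE_t (i : ZMod 4) : repE h (H.t q i) = opE q d k0 k1 k2 k3 i := H.lift_t ..

theorem repE_tinv (i : ZMod 4) : repE h (H.tinv q i) =
    (kE k0 k1 k2 k3 i + (kE k0 k1 k2 k3 i)⁻¹) • 1 - opE q d k0 k1 k2 k3 i := H.lift_tinv ..

/-- The operators of `t_i` on `E(k₀, k₁, k₂, k₃)^{1 mod 4}`. -/
noncomputable def opE1 (q : F) (d : ℕ) (k0 k1 k2 k3 : F) (i : ZMod 4) :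
    Module.End F (Fin (d + 1) → F) :=
  opE q d k0 k1 k2 k3 (i + 1)

/-- The scalars by which `t_i + t_i⁻¹` acts on `E(k₀, k₁, k₂, k₃)^{1 mod 4}`. -/
def cE1 (k0 k1 k2 k3 : F) (i : ZMod 4) : F :=
  kE k0 k1 k2 k3 (i + 1) + (kE k0 k1 k2 k3 (i + 1))⁻¹

/-- The representation of `𝔥_q` on `E(k₀, k₁, k₂, k₃)^{1 mod 4}`. -/
noncomputable def repE1 : H q →ₐ[F] Module.End F (Fin (d + 1) → F) :=
  (repE h).comp (H.shift q 1 : H q →ₐ[F] H q)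

theorem smul_UAW_E1 (x : UAW q) (v : E1 h) : x • v = repE1 h (zeta q x) v := rfl

theorem repE1_t (i : ZMod 4) : repE1 h (H.t q i) = opE1 q d k0 k1 k2 k3 i :=
  (congrArg (repE h) (H.shift_t 1 i)).trans (repE_t h (i + 1))

theorem repE1_tinv (i : ZMod 4) : repE1 h (H.tinv q i) =
    quadInv (opE1 q d k0 k1 k2 k3) (cE1 k0 k1 k2 k3) i :=
  (congrArg (repE h) (H.shift_tinv 1 i)).trans (repE_tinv h (i + 1))

theorem repE1_pair (i : ZMod 4) : repE1 h (H.pair q i) =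
    quadPair (opE1 q d k0 k1 k2 k3) (cE1 k0 k1 k2 k3) i := by
  rw [H.pair, map_add, map_mul, map_mul, repE1_t, repE1_t, repE1_tinv, repE1_tinv, quadPair]

theorem isQuad_opE1 (h : Admissible q d k0 k1 k2 k3) :
    IsQuad q (opE1 q d k0 k1 k2 k3) (cE1 k0 k1 k2 k3) where
  sq i := opE_sq hq.ne_zero h (i + 1)
  prod i := by
    have e := congrArg (repE1 h) (H.prod_shift q i)
    rwa [map_mul, map_mul, map_mul, repE1_t, repE1_t, repE1_t, repE1_t, AlgHom.commutes,
      Algebra.algebraMap_eq_smul_one, zero_add, add_comm 1, add_comm 2, add_comm 3] at e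

theorem opE1_irreducible [hirr : IsSimpleModule (H q) (E1 h)]
    (M : Submodule F (Fin (d + 1) → F)) (hM : ∀ i, ∀ x ∈ M, opE1 q d k0 k1 k2 k3 i x ∈ M) :
    M = ⊥ ∨ M = ⊤ := by
  have hst := H.apply_mem (repE1 h) (M := M) (fun i v hv => by rw [repE1_t]; exact hM i v hv)
    (fun i v hv => by
      rw [repE1_tinv]
      exact M.sub_mem (M.smul_mem _ hv) (hM i v hv))
  let M' : Submodule (H q) (E1 h) :=
    { carrier := show Set (E1 h) from (M : Set (Fin (d + 1) → F))
      zero_mem' := M.zero_mem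
      add_mem' := M.add_mem
      smul_mem' := fun x v hv => hst x v hv }
  have hM' (v : Fin (d + 1) → F) : v ∈ M ↔ (show E1 h from v) ∈ M' := Iff.rfl
  rcases eq_bot_or_eq_top M' with e | e
  · refine Or.inl (eq_bot_iff.2 fun v hv => ?_)
    rw [hM', e] at hv
    exact hv
  · refine Or.inr (eq_top_iff.2 fun v _ => ?_)
    rw [hM', e]
    trivial

/-- A `△_q`-submodule of `E(k₀, k₁, k₂, k₃)^{1 mod 4}` as a subspace of `F^{d+1}`. -/
def toSubspace (W : Submodule (UAW q) (E1 h)) : Submodule F (Fin (d + 1) → F) where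
  carrier := show Set (Fin (d + 1) → F) from (W : Set (E1 h))
  zero_mem' := W.zero_mem
  add_mem' := W.add_mem
  smul_mem' a v hv := by
    have key (v : E1 h) (hv : v ∈ W) : a • v ∈ W := by
      have e := W.smul_mem (algebraMap F (UAW q) a) hv
      rw [smul_UAW_E1, AlgHom.commutes, AlgHom.commutes] at e
      exact e
    exact key v hv

theorem mem_toSubspace {W : Submodule (UAW q) (E1 h)} {v : E1 h} :
    (show Fin (d + 1) → F from v) ∈ toSubspace h W ↔ v ∈ W := Iff.rfl

theorem mem_eigen_E1 {θ : F} {v : E1 h} :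
    v ∈ eigen q (E1 h) θ ↔
      ofBasis d (act1 q d k0 k1) (show Fin (d + 1) → F from v) = θ • v := by
  change repE1 h (H.t q 0) v = θ • v ↔ _
  rw [repE1_t]
  rfl

theorem quadPair_mem_toSubspace (W : Submodule (UAW q) (E1 h)) (i : ZMod 4)
    (v : Fin (d + 1) → F) (hv : v ∈ toSubspace h W) :
    quadPair (opE1 q d k0 k1 k2 k3) (cE1 k0 k1 k2 k3) i v ∈ toSubspace h W := by
  have key (g : AWGen) : repE1 h (zetaGen q g) v ∈ toSubspace h W := by
    rw [← zeta_gen]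
    exact W.smul_mem (UAW.gen q g) hv
  fin_cases i
  -- The index 0 is not the image of a generator of △_q, but t_0² + t_0⁻² is the scalar c_0² - 2.
  -- The indices 1, 2, 3 correspond to A, C, B.
  · have e := LinearMap.congr_fun ((isQuad_opE1 h).sq 0) v
    change opE1 q d k0 k1 k2 k3 0 (opE1 q d k0 k1 k2 k3 0 v) =
      cE1 k0 k1 k2 k3 0 • opE1 q d k0 k1 k2 k3 0 v - v at e
    have e' : quadPair (opE1 q d k0 k1 k2 k3) (cE1 k0 k1 k2 k3) 0 v =
        (cE1 k0 k1 k2 k3 0 ^ 2 - 2) • v := by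
      simp only [quadPair, quadInv, LinearMap.add_apply, Module.End.mul_apply, LinearMap.sub_apply,
        LinearMap.smul_apply, Module.End.one_apply, map_sub, map_smul, e]
      module
    change quadPair (opE1 q d k0 k1 k2 k3) (cE1 k0 k1 k2 k3) 0 v ∈ _
    rw [e']
    exact Submodule.smul_mem _ _ hv
  · exact repE1_pair h 1 ▸ key .A
  · exact repE1_pair h 2 ▸ key .C
  · exact repE1_pair h 3 ▸ key .B

/-- The `△_q`-submodules of an irreducible `E(k₀, k₁, k₂, k₃)^{1 mod 4}`. -/
theorem E1_submodule [hirr : IsSimpleModule (H q) (E1 h)] (W : Submodule (UAW q) (E1 h)) :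
    W = ⊥ ∨ W = eigen q (E1 h) k1 ∨ W = eigen q (E1 h) k1⁻¹ ∨ W = ⊤ := by
  have hQ := isQuad_opE1 h
  have hq0 := hq.ne_zero
  have hirr' := opE1_irreducible h
  have hW := quadPair_mem_toSubspace h W
  have hc : cE1 k0 k1 k2 k3 0 = k1 + k1⁻¹ := rfl
  have hc' : cE1 k0 k1 k2 k3 0 = k1⁻¹ + k1⁻¹⁻¹ := by rw [inv_inv, hc, add_comm]
  have top (e : toSubspace h W = ⊤) : W = ⊤ :=
    eq_top_iff.2 fun v _ => (mem_toSubspace h).1 (e ▸ Submodule.mem_top)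
  by_cases h1 : ∃ w ∈ toSubspace h W, opE1 q d k0 k1 k2 k3 0 w = k1 • w ∧ w ≠ 0
  · rcases hQ.eq_eigen_or_top hq0 hirr' h.ne1 hc (fun x hx => ker_eq_range hq0 h hx) hW h1 with e | e
    · exact Or.inr (Or.inl (Submodule.ext fun v => (e v).trans (mem_eigen_E1 h).symm))
    · exact Or.inr (Or.inr (Or.inr (top e)))
  by_cases h2 : ∃ w ∈ toSubspace h W, opE1 q d k0 k1 k2 k3 0 w = k1⁻¹ • w ∧ w ≠ 0
  · rcases hQ.eq_eigen_or_top hq0 hirr' (inv_ne_zero h.ne1) hc'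
      (fun x hx => by rw [inv_inv]; exact ker_eq_range' hq0 h hx) hW h2 with e | e
    · exact Or.inr (Or.inr (Or.inl (Submodule.ext fun v => (e v).trans (mem_eigen_E1 h).symm)))
    · exact Or.inr (Or.inr (Or.inr (top e)))
  push Not at h1 h2
  refine Or.inl ?_
  by_contra hne
  have hne' : toSubspace h W ≠ ⊥ := fun e => hne (eq_bot_iff.2 fun v hv => by
    have : (show Fin (d + 1) → F from v) ∈ toSubspace h W := hv
    rw [e] at this
    exact this)
  obtain ⟨z1, z2⟩ := hQ.trace_eq_zero_of_disjoint hq0 (hq.pow_ne_one 2 (by norm_num)) hirr' h.ne1 hc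
    (fun x hx => ker_eq_range' hq0 h hx) hW hne' h1 h2
  -- On E¹ the pair of index 3 is t_0 t_1 + (t_0 t_1)⁻¹ of E, because the twist moves indices 3 and
  -- 0 to 0 and 1.
  exact trace_opB_ne_zero h z1
    (z2 (oddProj F d) T1_oddProj (fun x hx => oddProj_eq_self hq0 h hx))

theorem eigen_E1_ne_top (a : F) : eigen q (E1 h) a ≠ ⊤ := fun e =>
  T1_zero_ne h a ((mem_eigen_E1 h).1
    (show (show E1 h from vec F d 0) ∈ eigen q (E1 h) a from e ▸ Submodule.mem_top))

/-- The vector (t_1 - a)v_0 of E is a nonzero eigenvector for a⁻¹. -/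
theorem eigen_E1_ne_bot {a : F} (ha : a ≠ 0) (hc : k1 + k1⁻¹ = a + a⁻¹) :
    eigen q (E1 h) a⁻¹ ≠ ⊥ := fun e => by
  have hm := (mem_eigen_E1 h).2 ((isQuad_opE1 h).eigen_sub ha hc (vec F d 0))
  rw [e] at hm
  exact T1_zero_ne h a (sub_eq_zero.1 hm)

theorem eigen_E1_disjoint {a b : F} (hab : a ≠ b) {W : Submodule (UAW q) (E1 h)}
    (ha : W ≤ eigen q (E1 h) a) (hb : W ≤ eigen q (E1 h) b) : W = ⊥ := by
  refine eq_bot_iff.2 fun v hv => (Submodule.mem_bot (UAW q)).2 ?_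
  have e : a • v = b • v := ((mem_eigen_E1 h).1 (ha hv)).symm.trans ((mem_eigen_E1 h).1 (hb hv))
  rw [← sub_eq_zero, ← sub_smul] at e
  exact (smul_eq_zero.1 e).resolve_left (sub_ne_zero.2 hab)

end Transfer

end DAHA

/-! ### The submodule lattice -/

theorem mainTheorem5 {F : Type*} [Field F] [IsAlgClosed F] (q : F) [DAHA.NotRootOfUnity q]
    (d : ℕ) (k0 k1 k2 k3 : F) (h : DAHA.Admissible q d k0 k1 k2 k3)
    (hirr : IsSimpleModule (DAHA.H q) (DAHA.E1 h)) :
    (k1 ^ 2 = 1 →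
      (∀ W : Submodule (DAHA.UAW q) (DAHA.E1 h),
        W = ⊥ ∨ W = DAHA.eigen q (DAHA.E1 h) k1 ∨ W = ⊤) ∧
      ⊥ ⋖ DAHA.eigen q (DAHA.E1 h) k1 ∧
      DAHA.eigen q (DAHA.E1 h) k1 ⋖ ⊤) ∧
    (k1 ^ 2 ≠ 1 →
      (∀ W : Submodule (DAHA.UAW q) (DAHA.E1 h),
        W = ⊥ ∨ W = DAHA.eigen q (DAHA.E1 h) k1 ∨ W = DAHA.eigen q (DAHA.E1 h) k1⁻¹ ∨ W = ⊤) ∧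
      DAHA.eigen q (DAHA.E1 h) k1 ≠ DAHA.eigen q (DAHA.E1 h) k1⁻¹ ∧
      ⊥ ⋖ DAHA.eigen q (DAHA.E1 h) k1 ∧
      ⊥ ⋖ DAHA.eigen q (DAHA.E1 h) k1⁻¹ ∧
      DAHA.eigen q (DAHA.E1 h) k1 ⋖ ⊤ ∧
      DAHA.eigen q (DAHA.E1 h) k1⁻¹ ⋖ ⊤) := by
  have all := DAHA.E1_submodule h
  have nt := DAHA.eigen_E1_ne_top h k1
  have nt' := DAHA.eigen_E1_ne_top h k1⁻¹
  have nb' := DAHA.eigen_E1_ne_bot h h.ne1 rfl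
  have nb := DAHA.eigen_E1_ne_bot h (inv_ne_zero h.ne1) (by rw [inv_inv, add_comm])
  rw [inv_inv] at nb
  constructor
  · intro hk
    -- Here k₁⁻¹ = k₁, so the two eigenspaces in the classification coincide.
    rw [inv_eq_of_mul_eq_one_left (show k1 * k1 = 1 by rw [← sq, hk])] at all
    refine ⟨fun W => ?_, ⟨bot_lt_iff_ne_bot.2 nb, fun W h1 h2 => ?_⟩,
      ⟨lt_top_iff_ne_top.2 nt, fun W h1 h2 => ?_⟩⟩
    · rcases all W with e | e | e | e <;> simp [e]
    · rcases all W with rfl | rfl | rfl | rfl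
      exacts [h1.false, h2.false, h2.false, not_top_lt h2]
    · rcases all W with rfl | rfl | rfl | rfl
      exacts [not_lt_bot h1, h1.false, h1.false, h2.false]
  · intro hk
    have hne : k1 ≠ k1⁻¹ := fun e => hk (by
      rw [sq]
      nth_rewrite 2 [e]
      exact mul_inv_cancel₀ h.ne1)
    -- Eigenspaces for different eigenvalues meet trivially, so an inclusion would make one of them
    -- zero. This incomparability also gives the four covering relations.
    have d1 : ¬ DAHA.eigen q (DAHA.E1 h) k1 ≤ DAHA.eigen q (DAHA.E1 h) k1⁻¹ := fun hle =>
      nb (DAHA.eigen_E1_disjoint h hne le_rfl hle)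
    have d2 : ¬ DAHA.eigen q (DAHA.E1 h) k1⁻¹ ≤ DAHA.eigen q (DAHA.E1 h) k1 := fun hle =>
      nb' (DAHA.eigen_E1_disjoint h hne hle le_rfl)
    refine ⟨all, fun e => d1 e.le, ⟨bot_lt_iff_ne_bot.2 nb, fun W h1 h2 => ?_⟩,
      ⟨bot_lt_iff_ne_bot.2 nb', fun W h1 h2 => ?_⟩, ⟨lt_top_iff_ne_top.2 nt, fun W h1 h2 => ?_⟩,
      ⟨lt_top_iff_ne_top.2 nt', fun W h1 h2 => ?_⟩⟩
    · rcases all W with rfl | rfl | rfl | rfl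
      exacts [h1.false, h2.false, d2 h2.le, not_top_lt h2]
    · rcases all W with rfl | rfl | rfl | rfl
      exacts [h1.false, d1 h2.le, h2.false, not_top_lt h2]
    · rcases all W with rfl | rfl | rfl | rfl
      exacts [not_lt_bot h1, h1.false, d1 h1.le, h2.false]
    · rcases all W with rfl | rfl | rfl | rfl
      exacts [not_lt_bot h1, d2 h1.le, h1.false, h2.false]
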